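/- All vector spaces are real. A Grassmann algebra is $A=\Lambda\mathbb R^n$ ($n\ge 0$) with its $\mathbb Z/2$-grading $A=A_0\oplus A_1$; homomorphisms of Grassmann algebras are unital algebra homomorphisms preserving the grading. For a finite-dimensional super vector space $V=V_0\oplus V_1$, the supermanifold $V$ is the functor sending $A$ to the finite-dimensional vector space $V_A=(A\otimes V)_0=A_0\otimes V_0\oplus A_1\otimes V_1$, which is an $A_0$-module and a manifold, and $f:A\to B$ to $V_f=(f\otimes 1)_0$. A smooth map $\varphi:V\to W$ of such supermanifolds is a natural transformation whose components $\varphi_A:V_A\to W_A$ are $A_0$-smooth, i.e. smooth with derivative $A_0$-linear at every point. The product of the supermanifolds $V$ and $W$ is the supermanifold $V\oplus W$, with $(V\oplus W)_A=V_A\times W_A$; the terminal object $1$ is $\mathbb R^{0|0}$; a supergroup is a group object for these smooth maps. A Lie superalgebra is a finite-dimensional super vector space $\mathfrak n$ with an even bilinear bracket satisfying $[X,Y]=-(-1)^{|X||Y|}[Y,X]$ and $[X,[Y,Z]]=[[X,Y],Z]+(-1)^{|X||Y|}[Y,[X,Z]]$ for homogeneous $X,Y,Z$. It is $k$-step nilpotent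 if all $k$-fold nested brackets $[X_1,[X_2,\dots,[X_k,Y]\dots]]$ vanish, and nilpotent if it is so for some $k$. The $A_0$-module $\mathfrak n_A$ is a Lie algebra over $A_0$ under the biadditive bracket with $[aX,bY]_A=ba\,[X,Y]$ for $a,X$ of equal parity and $b,Y$ of equal parity. **Proposition.** Let $\mathfrak n$ be a nilpotent Lie superalgebra. Then: 1. for every Grassmann algebra $A$ the Lie algebra $\mathfrak n_A$ is nilpotent; 2. the Baker–Campbell–Hausdorff series $Z(X,Y)=\log(\exp X\exp Y)=X+Y+\tfrac12[X,Y]_A+\cdots=\sum_{d\ge1}Z_d(X,Y)$ on $\mathfrak n_A$ terminates: there is $K$ such that its degree-$d$ homogeneous component (given by Dynkin's formula) satisfies $Z_d(X,Y)=0$ for all $d>K$, all $A$ and all $X,Y\in\mathfrak n_A$; 3. there is a supergroup $N$ on the supermanifold $\mathfrak n$ whose multiplication $m:N\times N\to N$, inverse $\mathrm{inv}:N\to N$ and identity $\mathrm{id}:1\to N$ (smooth maps of supermanifolds, i.e. natural in $A$ and $A_0$-smooth) are given on $A$-points, for every Grassmann algebra $A$ and all $X,Y\in\mathfrak n_A$,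 by $$m_A(X,Y)=Z(X,Y),\qquad \mathrm{inv}_A(X)=-X,\qquad \mathrm{id}_A(1)=0 .$$ -/

import Mathlib

open CategoryTheory MonoidalCategory CartesianMonoidalCategory
open scoped TensorProduct ContDiff

universe u

namespace SuperGeom

/-! ### Grassmann algebras -/

/-- The Grassmann algebra `Λ ℝⁿ`. -/
abbrev Gr (n : ℕ) : Type := ExteriorAlgebra ℝ (Fin n → ℝ)

/-- The homogeneous parts `A₀` (sum of the even exterior powers) and `A₁` (sum of the odd ones)
of the Grassmann algebra `A = Λ ℝⁿ`. -/
abbrev parity (n : ℕ) (i : ZMod 2) : Submodule ℝ (Gr n) :=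
  CliffordAlgebra.evenOdd (0 : QuadraticForm ℝ (Fin n → ℝ)) i

/-- The even part `A₀`, as a subalgebra. -/
abbrev EvenPart (n : ℕ) : Subalgebra ℝ (Gr n) :=
  CliffordAlgebra.even (0 : QuadraticForm ℝ (Fin n → ℝ))

theorem mem_even_iff {n : ℕ} {a : Gr n} : a ∈ EvenPart n ↔ a ∈ parity n 0 := Iff.rfl

theorem zmod_two_cases (i : ZMod 2) : i = 0 ∨ i = 1 := by
  revert i; decide

theorem ι_anticomm {n : ℕ} (u v : Fin n → ℝ) :
    ExteriorAlgebra.ι ℝ u * ExteriorAlgebra.ι ℝ v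
      = -(ExteriorAlgebra.ι ℝ v * ExteriorAlgebra.ι ℝ u) :=
  eq_neg_of_add_eq_zero_left (ExteriorAlgebra.ι_add_mul_swap u v)

theorem even_commute {n : ℕ} {a : Gr n} (ha : a ∈ parity n 0) (b : Gr n) : a * b = b * a := by
  have key : ∀ u v w : Fin n → ℝ, ExteriorAlgebra.ι ℝ u * ExteriorAlgebra.ι ℝ v *
      ExteriorAlgebra.ι ℝ w = ExteriorAlgebra.ι ℝ w *
        (ExteriorAlgebra.ι ℝ u * ExteriorAlgebra.ι ℝ v) := by
    intro u v w
    rw [mul_assoc, ι_anticomm v w, mul_neg, ← mul_assoc, ι_anticomm u w, neg_mul, neg_neg,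
      mul_assoc]
  have key2 : ∀ (u v : Fin n → ℝ) (b : Gr n), ExteriorAlgebra.ι ℝ u * ExteriorAlgebra.ι ℝ v * b
      = b * (ExteriorAlgebra.ι ℝ u * ExteriorAlgebra.ι ℝ v) := by
    intro u v b
    induction b using ExteriorAlgebra.induction with
    | algebraMap r => exact (Algebra.commutes r _).symm
    | ι w => exact key u v w
    | mul x y hx hy => rw [← mul_assoc, hx, mul_assoc, hy, mul_assoc]
    | add x y hx hy => rw [mul_add, add_mul, hx, hy]
  induction a, ha using CliffordAlgebra.even_induction with
  | algebraMap r => exact Algebra.commutes r b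
  | add x y hx hy ihx ihy => rw [add_mul, mul_add, ihx, ihy]
  | ι_mul_ι_mul u v x hx ih =>
    have h := key2 u v b
    change ExteriorAlgebra.ι ℝ u * ExteriorAlgebra.ι ℝ v * x * b
      = b * (ExteriorAlgebra.ι ℝ u * ExteriorAlgebra.ι ℝ v * x)
    rw [mul_assoc, ih, ← mul_assoc, h, mul_assoc]

theorem odd_anticommute {n : ℕ} {a b : Gr n} (ha : a ∈ parity n 1) (hb : b ∈ parity n 1) :
    a * b = -(b * a) := by
  induction a, ha using CliffordAlgebra.odd_induction with
  | ι u =>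
    induction b, hb using CliffordAlgebra.odd_induction with
    | ι v => exact ι_anticomm u v
    | add x y hx hy ihx ihy => rw [mul_add, add_mul, ihx, ihy, neg_add]
    | ι_mul_ι_mul v w x hx ih =>
      have hc := even_commute (CliffordAlgebra.ι_mul_ι_mem_evenOdd_zero
        (0 : QuadraticForm ℝ (Fin n → ℝ)) v w)
      rw [← mul_assoc, ← hc, mul_assoc, ih, mul_neg, ← mul_assoc]
  | add x y hx hy ihx ihy => rw [mul_add, add_mul, ihx, ihy, neg_add]
  | ι_mul_ι_mul u v x hx ih =>
    have hc := even_commute (CliffordAlgebra.ι_mul_ι_mem_evenOdd_zero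
      (0 : QuadraticForm ℝ (Fin n → ℝ)) u v)
    rw [mul_assoc, ih, mul_neg, ← mul_assoc, hc, mul_assoc]

/-- The sign `(-1) ^ (|i| |j|)` of the rule of signs. -/
def sgn (i j : ZMod 2) : ℝ := (-1) ^ (i.val * j.val)

theorem sgn_mul_self (i j : ZMod 2) : sgn i j * sgn i j = 1 := by
  rw [sgn, ← mul_pow]; norm_num

theorem graded_comm {n : ℕ} {i j : ZMod 2} {a b : Gr n} (ha : a ∈ parity n i)
    (hb : b ∈ parity n j) : a * b = sgn i j • (b * a) := by
  rcases zmod_two_cases i with rfl | rfl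
  · simp [sgn, even_commute ha b]
  · rcases zmod_two_cases j with rfl | rfl
    · simp [sgn, even_commute hb a]
    · simp [sgn, odd_anticommute ha hb, ZMod.val_one]

instance (n : ℕ) : CommRing (EvenPart n) :=
  { (inferInstance : Ring (EvenPart n)) with
    mul_comm := fun a b => Subtype.ext (even_commute a.2 b) }

instance (n : ℕ) : Module.Finite ℝ (Gr n) :=
  Module.Finite.of_basis (Pi.basisFun ℝ (Fin n)).ExteriorAlgebra

/-- Homomorphisms of Grassmann algebras: unital algebra homomorphisms that respect the
`ℤ/2`-grading. -/
structure GrHom (m n : ℕ) where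
  toAlgHom : Gr m →ₐ[ℝ] Gr n
  map_parity : ∀ (i : ZMod 2) (a : Gr m), a ∈ parity m i → toAlgHom a ∈ parity n i

/-- The identity homomorphism. -/
def GrHom.id (n : ℕ) : GrHom n n := ⟨AlgHom.id ℝ (Gr n), fun _ _ h => h⟩

/-- Composition of homomorphisms. -/
def GrHom.comp {l m n : ℕ} (g : GrHom m n) (f : GrHom l m) : GrHom l n :=
  ⟨g.toAlgHom.comp f.toAlgHom, fun i a h => g.map_parity i _ (f.map_parity i a h)⟩

/-! ### Super vector spaces and their `A`-points -/

/-- A finite-dimensional real super vector space `V = V₀ ⊕ V₁`. -/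
structure SuperSpace : Type (u + 1) where
  carrier : Type u
  [addCommGroup : AddCommGroup carrier]
  [module : Module ℝ carrier]
  [finite : FiniteDimensional ℝ carrier]
  part : ZMod 2 → Submodule ℝ carrier
  isCompl : IsCompl (part 0) (part 1)

attribute [instance] SuperSpace.addCommGroup SuperSpace.module SuperSpace.finite

/-- The even part `(A ⊗ V)₀ = (A₀ ⊗ V₀) ⊕ (A₁ ⊗ V₁)` of the super vector space `A ⊗ V`, where
`A = Λ ℝⁿ`, as an `A₀`-submodule of `A ⊗ V`. -/
def ptsSubmodule (V : SuperSpace.{u}) (n : ℕ) : Submodule (EvenPart n) (Gr n ⊗[ℝ] V.carrier) :=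
  Submodule.span (EvenPart n)
    {t | ∃ i : ZMod 2, ∃ a ∈ parity n i, ∃ v ∈ V.part i, t = a ⊗ₜ[ℝ] v}

/-- The set `V_A = (A ⊗ V)₀` of `A`-points of the supermanifold associated to `V`, for the
Grassmann algebra `A = Λ ℝⁿ`. -/
def Pts (V : SuperSpace.{u}) (n : ℕ) : Type u := ptsSubmodule V n

noncomputable section

variable (V W : SuperSpace.{u}) (n : ℕ)

instance : AddCommGroup (Pts V n) := inferInstanceAs (AddCommGroup (ptsSubmodule V n))

instance : Module (EvenPart n) (Pts V n) := inferInstanceAs (Module (EvenPart n) (ptsSubmodule V n))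

instance : Module ℝ (Pts V n) := inferInstanceAs (Module ℝ (ptsSubmodule V n))

instance : IsScalarTower ℝ (EvenPart n) (Pts V n) :=
  inferInstanceAs (IsScalarTower ℝ (EvenPart n) (ptsSubmodule V n))

instance : FiniteDimensional ℝ (Pts V n) :=
  inferInstanceAs (FiniteDimensional ℝ ((ptsSubmodule V n).restrictScalars ℝ))

/-- A norm on the finite-dimensional real vector space `V_A` (which one is immaterial: they are
all equivalent, so they define the same smooth maps and the same derivatives). -/
instance : NormedAddCommGroup (Pts V n) :=
  NormedAddCommGroup.induced (Pts V n) (Fin (Module.finrank ℝ (Pts V n)) → ℝ)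
    (Module.finBasis ℝ (Pts V n)).equivFun (Module.finBasis ℝ (Pts V n)).equivFun.injective

instance : NormedSpace ℝ (Pts V n) :=
  NormedSpace.induced ℝ (Pts V n) (Fin (Module.finrank ℝ (Pts V n)) → ℝ)
    (Module.finBasis ℝ (Pts V n)).equivFun

variable {V W n}

/-- The `A`-point `a ⊗ v`, for `a ∈ A` and `v ∈ V` of the same parity. -/
def Pts.tmul {i : ZMod 2} {a : Gr n} (ha : a ∈ parity n i) {v : V.carrier} (hv : v ∈ V.part i) :
    Pts V n :=
  ⟨a ⊗ₜ v, Submodule.subset_span ⟨i, a, ha, v, hv, rfl⟩⟩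

/-- The underlying element of `A ⊗ V`. -/
def Pts.val : Pts V n →ₗ[EvenPart n] Gr n ⊗[ℝ] V.carrier := (ptsSubmodule V n).subtype

theorem Pts.ext {x y : Pts V n} (h : x.val = y.val) : x = y := Subtype.ext h

theorem even_mul_mem {i : ZMod 2} {c a : Gr n} (hc : c ∈ parity n 0) (ha : a ∈ parity n i) :
    c * a ∈ parity n i := by
  have h := SetLike.mul_mem_graded (A := parity n) hc ha
  rwa [zero_add] at h

/-- The `A`-points are the sums of elements `a ⊗ v` with `a` and `v` of matching parity. -/
theorem Pts.induction {P : Pts V n → Prop} (zero : P 0)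
    (add : ∀ x y, P x → P y → P (x + y))
    (tmul : ∀ (i : ZMod 2) (a : Gr n) (ha : a ∈ parity n i) (v : V.carrier) (hv : v ∈ V.part i),
      P (Pts.tmul ha hv)) (x : Pts V n) : P x := by
  obtain ⟨x, hx⟩ := x
  induction hx using Submodule.closure_induction with
  | zero => exact zero
  | add x y hx hy ihx ihy => exact add _ _ ihx ihy
  | smul_mem c x h =>
    obtain ⟨i, a, ha, v, hv, rfl⟩ := h
    exact tmul i _ (even_mul_mem c.2 ha) v hv

/-- The map `V_f = (f ⊗ 1)₀ : V_A → V_B` induced by a homomorphism `f : A → B` of Grassmann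
algebras. -/
def Pts.map (V : SuperSpace.{u}) {m n : ℕ} (f : GrHom m n) : Pts V m →ₗ[ℝ] Pts V n where
  toFun x := ⟨LinearMap.rTensor V.carrier f.toAlgHom.toLinearMap x.val, by
    induction x using Pts.induction with
    | zero => rw [map_zero, map_zero]; exact zero_mem _
    | add x y hx hy => rw [map_add, map_add]; exact add_mem hx hy
    | tmul i a ha v hv =>
      exact Submodule.subset_span ⟨i, _, f.map_parity i a ha, v, hv, rfl⟩⟩
  map_add' x y := Pts.ext (by
    change LinearMap.rTensor _ _ (x.val + y.val) = _
    exact map_add _ _ _)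
  map_smul' r x := Pts.ext (by
    change LinearMap.rTensor _ _ (r • x.val) = _
    exact map_smul _ _ _)

@[simp] theorem Pts.map_id (x : Pts V n) : Pts.map V (GrHom.id n) x = x :=
  Pts.ext (LinearMap.rTensor_id_apply _ _ _)

theorem Pts.map_comp {l m n : ℕ} (g : GrHom m n) (f : GrHom l m) (x : Pts V l) :
    Pts.map V (g.comp f) x = Pts.map V g (Pts.map V f x) := by
  induction x using Pts.induction with
  | zero => simp only [map_zero]
  | add x y hx hy => simp only [map_add, hx, hy]
  | tmul i a ha v hv => exact Pts.ext rfl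

/-- The map `L_A = (1 ⊗ L)₀ : V_A → W_A` induced by an even linear map `L : V → W`. -/
def Pts.mapLin (L : V.carrier →ₗ[ℝ] W.carrier) (hL : ∀ i, ∀ v ∈ V.part i, L v ∈ W.part i)
    (n : ℕ) : Pts V n →ₗ[EvenPart n] Pts W n where
  toFun x := ⟨TensorProduct.AlgebraTensorModule.lTensor (Gr n) (Gr n) L x.val, by
    induction x using Pts.induction with
    | zero => rw [map_zero, map_zero]; exact zero_mem _
    | add x y hx hy => rw [map_add, map_add]; exact add_mem hx hy
    | tmul i a ha v hv => exact Submodule.subset_span ⟨i, a, ha, _, hL i v hv, rfl⟩⟩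
  map_add' x y := Pts.ext (by
    change TensorProduct.AlgebraTensorModule.lTensor (Gr n) (Gr n) L (x.val + y.val) = _
    exact map_add _ _ _)
  map_smul' r x := Pts.ext (by
    change TensorProduct.AlgebraTensorModule.lTensor (Gr n) (Gr n) L ((r : Gr n) • x.val) = _
    exact map_smul _ _ _)

theorem Pts.map_mapLin {L : V.carrier →ₗ[ℝ] W.carrier} (hL : ∀ i, ∀ v ∈ V.part i, L v ∈ W.part i)
    {m n : ℕ} (f : GrHom m n) (x : Pts V m) :
    Pts.mapLin L hL n (Pts.map V f x) = Pts.map W f (Pts.mapLin L hL m x) := by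
  induction x using Pts.induction with
  | zero => simp only [map_zero]
  | add x y hx hy => simp only [map_add, hx, hy]
  | tmul i a ha v hv => exact Pts.ext rfl

/-! ### Smooth maps of supermanifolds -/

/-- A map `V_A → W_A` is `A₀`-smooth if it is smooth and its derivative is `A₀`-linear at each
point. -/
def EvenSmooth (φ : Pts V n → Pts W n) : Prop :=
  ContDiff ℝ ∞ φ ∧
    ∀ (x : Pts V n) (a : EvenPart n) (v : Pts V n), fderiv ℝ φ x (a • v) = a • fderiv ℝ φ x v

theorem EvenSmooth.id : EvenSmooth (fun x : Pts V n => x) :=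
  ⟨contDiff_id, fun x a v => by simp⟩

theorem EvenSmooth.comp {U : SuperSpace.{u}} {ψ : Pts V n → Pts W n} {φ : Pts U n → Pts V n}
    (hψ : EvenSmooth ψ) (hφ : EvenSmooth φ) : EvenSmooth (fun x => ψ (φ x)) := by
  refine ⟨hψ.1.comp hφ.1, fun x a v => ?_⟩
  have h := fderiv_comp x ((hψ.1.differentiable (by simp)) (φ x))
    ((hφ.1.differentiable (by simp)) x)
  change fderiv ℝ (ψ ∘ φ) x (a • v) = a • fderiv ℝ (ψ ∘ φ) x v
  rw [h, ContinuousLinearMap.comp_apply, ContinuousLinearMap.comp_apply, hφ.2, hψ.2]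

theorem EvenSmooth.add {ψ φ : Pts V n → Pts W n}
    (hψ : EvenSmooth ψ) (hφ : EvenSmooth φ) : EvenSmooth (fun x => ψ x + φ x) := by
  refine ⟨hψ.1.add hφ.1, fun x a v => ?_⟩
  rw [fderiv_fun_add ((hψ.1.differentiable (by simp)) x) ((hφ.1.differentiable (by simp)) x),
    add_apply, add_apply, hψ.2, hφ.2, smul_add]

theorem EvenSmooth.linear (L : Pts V n →ₗ[EvenPart n] Pts W n) : EvenSmooth (fun x => L x) := by
  let L' : Pts V n →L[ℝ] Pts W n := (L.restrictScalars ℝ).toContinuousLinearMap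
  refine ⟨L'.contDiff, fun x a v => ?_⟩
  have h : fderiv ℝ (fun x => L x) x = L' := L'.fderiv
  rw [h]
  exact L.map_smul a v

/-- The supermanifold associated to a finite-dimensional super vector space `V`. Its `A`-points
are `V_A = Pts V n` for `A = Λ ℝⁿ`, and `f : A → B` acts on them by `Pts.map V f`. -/
structure LinearSupermanifold : Type (u + 1) where
  space : SuperSpace.{u}

/-- The `A`-points of a linear supermanifold, for `A = Λ ℝⁿ`. -/
abbrev LinearSupermanifold.pts (M : LinearSupermanifold.{u}) (n : ℕ) : Type u := Pts M.space n

/-- A smooth map of linear supermanifolds: a natural transformation (in the Grassmann algebra `A`)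
all of whose components are `A₀`-smooth. -/
structure SmoothMap (M N : LinearSupermanifold.{u}) : Type u where
  app : ∀ n : ℕ, M.pts n → N.pts n
  naturality : ∀ {m n : ℕ} (f : GrHom m n) (x : M.pts m),
    app n (Pts.map M.space f x) = Pts.map N.space f (app m x)
  smooth : ∀ n : ℕ, EvenSmooth (app n)

theorem SmoothMap.ext' {M N : LinearSupermanifold.{u}} {f g : SmoothMap M N}
    (h : ∀ n x, f.app n x = g.app n x) : f = g := by
  obtain ⟨f, _, _⟩ := f
  obtain ⟨g, _, _⟩ := g
  obtain rfl : f = g := funext fun n => funext fun x => h n x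
  rfl

/-- The category of the supermanifolds associated to finite-dimensional super vector spaces, with
all smooth maps of supermanifolds between them as morphisms (a full subcategory, closed under
finite products, of the category of supermanifolds). -/
instance : Category.{u} LinearSupermanifold.{u} where
  Hom := SmoothMap
  id M := ⟨fun _ x => x, fun _ _ => rfl, fun _ => EvenSmooth.id⟩
  comp f g := ⟨fun n x => g.app n (f.app n x),
    fun h x => by rw [f.naturality, g.naturality], fun n => (g.smooth n).comp (f.smooth n)⟩

/-- The component on `A`-points of a morphism, for `A = Λ ℝⁿ`. -/
def onPts {M N : LinearSupermanifold.{u}} (f : M ⟶ N) (n : ℕ) : M.pts n → N.pts n :=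
  SmoothMap.app f n

theorem hom_ext {M N : LinearSupermanifold.{u}} {f g : M ⟶ N}
    (h : ∀ n x, onPts f n x = onPts g n x) : f = g := SmoothMap.ext' h

@[simp] theorem onPts_comp {L M N : LinearSupermanifold.{u}} (f : L ⟶ M) (g : M ⟶ N) (n : ℕ)
    (x : L.pts n) : onPts (f ≫ g) n x = onPts g n (onPts f n x) := rfl

@[simp] theorem onPts_id (M : LinearSupermanifold.{u}) (n : ℕ) (x : M.pts n) :
    onPts (𝟙 M) n x = x := rfl

/-! ### Finite products -/

/-- The super vector space `ℝ^{0|0}`. -/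
def SuperSpace.unit : SuperSpace.{u} where
  carrier := PUnit.{u + 1}
  part _ := ⊥
  isCompl := by
    rw [Subsingleton.elim (⊥ : Submodule ℝ PUnit.{u + 1}) ⊤, isCompl_iff]
    exact ⟨fun x _ _ => (Subsingleton.elim x ⊥).le, fun x _ _ => (Subsingleton.elim ⊤ x).le⟩

instance (n : ℕ) : Subsingleton (Pts SuperSpace.unit.{u} n) :=
  subsingleton_of_forall_eq 0 fun x => by
    induction x using Pts.induction with
    | zero => rfl
    | add x y hx hy => rw [hx, hy, add_zero]
    | tmul i a ha v hv => exact Pts.ext (TensorProduct.tmul_zero _ a)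

/-- The direct sum of super vector spaces. -/
def SuperSpace.prod (V W : SuperSpace.{u}) : SuperSpace.{u} where
  carrier := V.carrier × W.carrier
  part i := (V.part i).prod (W.part i)
  isCompl := by
    refine ⟨?_, ?_⟩
    · rw [disjoint_iff, Submodule.prod_inf_prod, V.isCompl.inf_eq_bot, W.isCompl.inf_eq_bot,
        Submodule.prod_bot]
    · rw [codisjoint_iff, Submodule.prod_sup_prod, V.isCompl.sup_eq_top, W.isCompl.sup_eq_top,
        Submodule.prod_top]

/-- The projection `(V ⊕ W)_A → V_A`. -/
def Pts.fst (V W : SuperSpace.{u}) (n : ℕ) : Pts (V.prod W) n →ₗ[EvenPart n] Pts V n :=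
  Pts.mapLin (V := V.prod W) (W := V) (LinearMap.fst ℝ V.carrier W.carrier)
    (fun _ _ h => h.1) n

/-- The projection `(V ⊕ W)_A → W_A`. -/
def Pts.snd (V W : SuperSpace.{u}) (n : ℕ) : Pts (V.prod W) n →ₗ[EvenPart n] Pts W n :=
  Pts.mapLin (V := V.prod W) (W := W) (LinearMap.snd ℝ V.carrier W.carrier)
    (fun _ _ h => h.2) n

/-- The inclusion `V_A → (V ⊕ W)_A`. -/
def Pts.inl (V W : SuperSpace.{u}) (n : ℕ) : Pts V n →ₗ[EvenPart n] Pts (V.prod W) n :=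
  Pts.mapLin (V := V) (W := V.prod W) (LinearMap.inl ℝ V.carrier W.carrier)
    (fun _ _ h => ⟨h, zero_mem _⟩) n

/-- The inclusion `W_A → (V ⊕ W)_A`. -/
def Pts.inr (V W : SuperSpace.{u}) (n : ℕ) : Pts W n →ₗ[EvenPart n] Pts (V.prod W) n :=
  Pts.mapLin (V := W) (W := V.prod W) (LinearMap.inr ℝ V.carrier W.carrier)
    (fun _ _ h => ⟨zero_mem _, h⟩) n

@[simp] theorem Pts.fst_inl (x : Pts V n) : Pts.fst V W n (Pts.inl V W n x) = x := by
  induction x using Pts.induction with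
  | zero => simp only [map_zero]
  | add x y hx hy => simp only [map_add, hx, hy]
  | tmul i a ha v hv => exact Pts.ext rfl

@[simp] theorem Pts.snd_inr (x : Pts W n) : Pts.snd V W n (Pts.inr V W n x) = x := by
  induction x using Pts.induction with
  | zero => simp only [map_zero]
  | add x y hx hy => simp only [map_add, hx, hy]
  | tmul i a ha v hv => exact Pts.ext rfl

@[simp] theorem Pts.fst_inr (x : Pts W n) : Pts.fst V W n (Pts.inr V W n x) = 0 := by
  induction x using Pts.induction with
  | zero => simp only [map_zero]
  | add x y hx hy => simp only [map_add, hx, hy, add_zero]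
  | tmul i a ha v hv => exact Pts.ext (TensorProduct.tmul_zero _ a)

@[simp] theorem Pts.snd_inl (x : Pts V n) : Pts.snd V W n (Pts.inl V W n x) = 0 := by
  induction x using Pts.induction with
  | zero => simp only [map_zero]
  | add x y hx hy => simp only [map_add, hx, hy, add_zero]
  | tmul i a ha v hv => exact Pts.ext (TensorProduct.tmul_zero _ a)

theorem Pts.inl_fst_add_inr_snd (z : Pts (V.prod W) n) :
    Pts.inl V W n (Pts.fst V W n z) + Pts.inr V W n (Pts.snd V W n z) = z := by
  induction z using Pts.induction with
  | zero => simp only [map_zero, add_zero]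
  | add x y hx hy =>
    nth_rewrite 3 [← hx]
    nth_rewrite 3 [← hy]
    simp only [map_add]
    abel
  | tmul i a ha v hv =>
    refine Pts.ext ?_
    change (a ⊗ₜ[ℝ] ((v.1, 0) : V.carrier × W.carrier) : Gr n ⊗[ℝ] (V.carrier × W.carrier))
      + a ⊗ₜ[ℝ] ((0, v.2) : V.carrier × W.carrier) = a ⊗ₜ[ℝ] v
    rw [← TensorProduct.tmul_add, Prod.mk_add_mk, add_zero, zero_add]
    rfl

/-- The morphism of supermanifolds given by an even linear map. -/
def linearHom (L : V.carrier →ₗ[ℝ] W.carrier) (hL : ∀ i, ∀ v ∈ V.part i, L v ∈ W.part i) :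
    LinearSupermanifold.mk V ⟶ LinearSupermanifold.mk W :=
  SmoothMap.mk (fun n x => Pts.mapLin L hL n x) (fun f x => Pts.map_mapLin hL f x)
    (fun n => EvenSmooth.linear _)

/-- The first projection from the product. -/
def fstHom (M N : LinearSupermanifold.{u}) :
    LinearSupermanifold.mk (M.space.prod N.space) ⟶ M :=
  linearHom (V := M.space.prod N.space) (W := M.space)
    (LinearMap.fst ℝ M.space.carrier N.space.carrier) (fun _ _ h => h.1)

/-- The second projection from the product. -/
def sndHom (M N : LinearSupermanifold.{u}) :
    LinearSupermanifold.mk (M.space.prod N.space) ⟶ N :=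
  linearHom (V := M.space.prod N.space) (W := N.space)
    (LinearMap.snd ℝ M.space.carrier N.space.carrier) (fun _ _ h => h.2)

/-- The map into a product with given components. -/
def liftHom {T M N : LinearSupermanifold.{u}} (f : T ⟶ M) (g : T ⟶ N) :
    T ⟶ LinearSupermanifold.mk (M.space.prod N.space) :=
  SmoothMap.mk
    (fun n x => Pts.inl M.space N.space n (SmoothMap.app f n x)
      + Pts.inr M.space N.space n (SmoothMap.app g n x))
    (fun h x => by
      rw [f.naturality, g.naturality, map_add]
      congr 1
      · exact Pts.map_mapLin _ h _
      · exact Pts.map_mapLin _ h _)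
    (fun n => ((EvenSmooth.linear _).comp (f.smooth n)).add
      ((EvenSmooth.linear _).comp (g.smooth n)))

/-- The one-point supermanifold is terminal. -/
def unitLimitCone : Limits.LimitCone (Functor.empty.{0} LinearSupermanifold.{u}) where
  cone := Limits.asEmptyCone (LinearSupermanifold.mk SuperSpace.unit)
  isLimit := Limits.IsTerminal.ofUniqueHom
    (fun _ => SmoothMap.mk (fun _ _ => 0) (fun _ _ => Subsingleton.elim _ _)
      (fun _ => EvenSmooth.linear 0))
    (fun _ _ => hom_ext fun n _ => Subsingleton.elim (α := Pts SuperSpace.unit n) _ _)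

/-- The supermanifold of `V ⊕ W` is the product of those of `V` and `W`. -/
def prodLimitCone (M N : LinearSupermanifold.{u}) : Limits.LimitCone (Limits.pair M N) where
  cone := Limits.BinaryFan.mk (fstHom M N) (sndHom M N)
  isLimit := Limits.BinaryFan.IsLimit.mk _ (fun f g => liftHom f g)
    (fun f g => hom_ext fun n x => by
      change Pts.fst M.space N.space n (Pts.inl _ _ n _ + Pts.inr _ _ n _) = _
      rw [map_add, Pts.fst_inl, Pts.fst_inr, add_zero]
      rfl)
    (fun f g => hom_ext fun n x => by
      change Pts.snd M.space N.space n (Pts.inl _ _ n _ + Pts.inr _ _ n _) = _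
      rw [map_add, Pts.snd_inl, Pts.snd_inr, zero_add]
      rfl)
    (fun f g m h₁ h₂ => hom_ext fun n x => by
      subst h₁ h₂
      exact (Pts.inl_fst_add_inr_snd (onPts m n x)).symm)

instance : CartesianMonoidalCategory LinearSupermanifold.{u} :=
  CartesianMonoidalCategory.ofChosenFiniteProducts unitLimitCone prodLimitCone

/-- The `A`-point `(x, y)` of the product `M × N`, for `A`-points `x` of `M` and `y` of `N`. -/
def pair {M N : LinearSupermanifold.{u}} {n : ℕ} (x : M.pts n) (y : N.pts n) : (M ⊗ N).pts n :=
  Pts.inl M.space N.space n x + Pts.inr M.space N.space n y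

@[simp] theorem fst_pair {M N : LinearSupermanifold.{u}} {n : ℕ} (x : M.pts n) (y : N.pts n) :
    onPts (fst M N) n (pair x y) = x := by
  change Pts.fst M.space N.space n (Pts.inl _ _ n _ + Pts.inr _ _ n _) = _
  rw [map_add, Pts.fst_inl, Pts.fst_inr, add_zero]

@[simp] theorem snd_pair {M N : LinearSupermanifold.{u}} {n : ℕ} (x : M.pts n) (y : N.pts n) :
    onPts (snd M N) n (pair x y) = y := by
  change Pts.snd M.space N.space n (Pts.inl _ _ n _ + Pts.inr _ _ n _) = _
  rw [map_add, Pts.snd_inl, Pts.snd_inr, zero_add]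

/-- Every `A`-point of a product is a pair of `A`-points of the factors. -/
theorem pair_fst_snd {M N : LinearSupermanifold.{u}} {n : ℕ} (z : (M ⊗ N).pts n) :
    pair (onPts (fst M N) n z) (onPts (snd M N) n z) = z :=
  Pts.inl_fst_add_inr_snd (V := M.space) (W := N.space) z

/-! ### Lie superalgebras -/

/-- A finite-dimensional real Lie superalgebra. -/
structure LieSuperalgebra : Type (u + 1) extends SuperSpace.{u} where
  bracket : carrier →ₗ[ℝ] carrier →ₗ[ℝ] carrier
  bracket_mem : ∀ i j : ZMod 2, ∀ X ∈ part i, ∀ Y ∈ part j, bracket X Y ∈ part (i + j)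
  antisymm : ∀ i j : ZMod 2, ∀ X ∈ part i, ∀ Y ∈ part j,
    bracket X Y = -(sgn i j • bracket Y X)
  jacobi : ∀ i j k : ZMod 2, ∀ X ∈ part i, ∀ Y ∈ part j, ∀ Z ∈ part k,
    bracket X (bracket Y Z) = bracket (bracket X Y) Z + sgn i j • bracket Y (bracket X Z)

/-- `k`-step nilpotent: any `k` nested brackets `[X₁, [X₂, … [X_k, Y] … ]]` vanish. -/
def LieSuperalgebra.IsStepNilpotent (g : LieSuperalgebra.{u}) (k : ℕ) : Prop :=
  ∀ (X : Fin k → g.carrier) (Y : g.carrier),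
    (List.ofFn X).foldr (fun x y => g.bracket x y) Y = 0

/-- Nilpotent: `k`-step nilpotent for some `k`. -/
def LieSuperalgebra.IsNilpotent (g : LieSuperalgebra.{u}) : Prop :=
  ∃ k : ℕ, g.IsStepNilpotent k

variable (g : LieSuperalgebra.{u})

/-- The supermanifold underlying a Lie superalgebra. -/
abbrev LieSuperalgebra.supermanifold : LinearSupermanifold.{u} := ⟨g.toSuperSpace⟩

/-- The `ℝ`-bilinear map on `A ⊗ g` with `(a ⊗ X, b ⊗ Y) ↦ b a ⊗ [X, Y]`. -/
def LieSuperalgebra.tensorBracket (n : ℕ) :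
    Gr n ⊗[ℝ] g.carrier →ₗ[ℝ] Gr n ⊗[ℝ] g.carrier →ₗ[ℝ] Gr n ⊗[ℝ] g.carrier :=
  TensorProduct.map₂ (LinearMap.mul ℝ (Gr n)).flip g.bracket

theorem LieSuperalgebra.tensorBracket_tmul (a b : Gr n) (X Y : g.carrier) :
    g.tensorBracket n (a ⊗ₜ X) (b ⊗ₜ Y) = (b * a) ⊗ₜ[ℝ] g.bracket X Y := rfl

variable {g}

theorem LieSuperalgebra.tensorBracket_mem (x y : Pts g.toSuperSpace n) :
    g.tensorBracket n x.val y.val ∈ ptsSubmodule g.toSuperSpace n := by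
  induction x using Pts.induction with
  | zero => rw [map_zero, map_zero]; exact zero_mem _
  | add x x' hx hx' => rw [map_add, map_add]; exact add_mem hx hx'
  | tmul i a ha X hX =>
    induction y using Pts.induction with
    | zero => rw [map_zero, map_zero]; exact zero_mem _
    | add y y' hy hy' => rw [map_add, map_add]; exact add_mem hy hy'
    | tmul j b hb Y hY =>
      refine Submodule.subset_span ⟨j + i, b * a, SetLike.mul_mem_graded hb ha, g.bracket X Y,
        ?_, rfl⟩
      rw [add_comm]
      exact g.bracket_mem i j X hX Y hY

/-- The bracket on the `A`-points `g_A`: it is biadditive, and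
`[a X, b Y]_A = b a [X, Y]` for `a`, `X` of the same parity and `b`, `Y` of the same parity. -/
instance : Bracket (Pts g.toSuperSpace n) (Pts g.toSuperSpace n) :=
  ⟨fun x y => ⟨g.tensorBracket n x.val y.val, g.tensorBracket_mem x y⟩⟩

theorem val_lie (x y : Pts g.toSuperSpace n) :
    (⁅x, y⁆ : Pts g.toSuperSpace n).val = g.tensorBracket n x.val y.val := rfl

theorem pts_add_lie (x y z : Pts g.toSuperSpace n) : ⁅x + y, z⁆ = ⁅x, z⁆ + ⁅y, z⁆ :=
  Pts.ext (by simp only [val_lie, map_add, LinearMap.add_apply])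

theorem pts_lie_add (x y z : Pts g.toSuperSpace n) : ⁅x, y + z⁆ = ⁅x, y⁆ + ⁅x, z⁆ :=
  Pts.ext (by simp only [val_lie, map_add])

theorem pts_zero_lie (x : Pts g.toSuperSpace n) : ⁅(0 : Pts g.toSuperSpace n), x⁆ = 0 :=
  Pts.ext (by simp only [val_lie, map_zero, LinearMap.zero_apply])

theorem pts_lie_zero (x : Pts g.toSuperSpace n) : ⁅x, (0 : Pts g.toSuperSpace n)⁆ = 0 :=
  Pts.ext (by simp only [val_lie, map_zero])

theorem pts_lie_antisymm (x y : Pts g.toSuperSpace n) : ⁅x, y⁆ = -⁅y, x⁆ := by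
  induction x using Pts.induction with
  | zero => rw [pts_zero_lie, pts_lie_zero, neg_zero]
  | add x x' hx hx' => rw [pts_add_lie, pts_lie_add, hx, hx', neg_add]
  | tmul i a ha X hX =>
    induction y using Pts.induction with
    | zero => rw [pts_zero_lie, pts_lie_zero, neg_zero]
    | add y y' hy hy' => rw [pts_add_lie, pts_lie_add, hy, hy', neg_add]
    | tmul j b hb Y hY =>
      refine Pts.ext ?_
      change (b * a) ⊗ₜ[ℝ] g.bracket X Y = -((a * b) ⊗ₜ[ℝ] g.bracket Y X)
      rw [graded_comm ha hb, g.antisymm i j X hX Y hY, TensorProduct.tmul_neg,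
        TensorProduct.tmul_smul, TensorProduct.smul_tmul']

theorem pts_leibniz (x y z : Pts g.toSuperSpace n) : ⁅x, ⁅y, z⁆⁆ = ⁅⁅x, y⁆, z⁆ + ⁅y, ⁅x, z⁆⁆ := by
  induction x using Pts.induction with
  | zero => simp only [pts_zero_lie, pts_lie_zero, add_zero]
  | add x x' hx hx' => simp only [pts_add_lie, pts_lie_add, hx, hx']; abel
  | tmul i a ha X hX =>
    induction y using Pts.induction with
    | zero => simp only [pts_zero_lie, pts_lie_zero, add_zero]
    | add y y' hy hy' => simp only [pts_add_lie, pts_lie_add, hy, hy']; abel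
    | tmul j b hb Y hY =>
      induction z using Pts.induction with
      | zero => simp only [pts_lie_zero, add_zero]
      | add z z' hz hz' => simp only [pts_lie_add, hz, hz']; abel
      | tmul k c hc Z hZ =>
        refine Pts.ext ?_
        change (c * b * a) ⊗ₜ[ℝ] g.bracket X (g.bracket Y Z)
          = (c * (b * a)) ⊗ₜ[ℝ] g.bracket (g.bracket X Y) Z
            + (c * a * b) ⊗ₜ[ℝ] g.bracket Y (g.bracket X Z)
        rw [g.jacobi i j k X hX Y hY Z hZ, TensorProduct.tmul_add, mul_assoc c a b,
          graded_comm ha hb, mul_assoc c b a, TensorProduct.tmul_smul, mul_smul_comm,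
          TensorProduct.smul_tmul']

/-- The Lie algebra `g_A`. -/
instance : LieRing (Pts g.toSuperSpace n) where
  add_lie := pts_add_lie
  lie_add := pts_lie_add
  lie_self x := by
    have h := pts_lie_antisymm x x
    have h2 : (2 : ℝ) • ⁅x, x⁆ = 0 := by
      rw [two_smul]
      nth_rewrite 1 [h]
      exact neg_add_cancel _
    exact (smul_eq_zero.mp h2).resolve_left two_ne_zero
  leibniz_lie := pts_leibniz

instance : LieAlgebra ℝ (Pts g.toSuperSpace n) where
  lie_smul r x y := Pts.ext (by
    change g.tensorBracket n x.val (r • y.val) = r • g.tensorBracket n x.val y.val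
    exact map_smul _ _ _)

/-- The bracket of `g_A` is `A₀`-bilinear. -/
instance : LieAlgebra (EvenPart n) (Pts g.toSuperSpace n) where
  lie_smul c x y := by
    induction x using Pts.induction with
    | zero => simp only [zero_lie, smul_zero]
    | add x x' hx hx' => simp only [add_lie, smul_add, hx, hx']
    | tmul i a ha X hX =>
      induction y using Pts.induction with
      | zero => simp only [lie_zero, smul_zero]
      | add y y' hy hy' => simp only [lie_add, smul_add, hy, hy']
      | tmul j b hb Y hY =>
        refine Pts.ext ?_
        change ((c : Gr n) * b * a) ⊗ₜ[ℝ] g.bracket X Y = ((c : Gr n) * (b * a)) ⊗ₜ[ℝ] g.bracket X Y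
        rw [mul_assoc]

/-! ### The Baker–Campbell–Hausdorff series -/

/-- The right-nested bracket `[w₁, [w₂, … [w_{d-1}, w_d] … ]]` of a word. -/
def nestedLie {L : Type*} [LieRing L] : List L → L
  | [] => 0
  | [x] => x
  | x :: y :: w => ⁅x, nestedLie (y :: w)⁆

/-- The homogeneous component of degree `d` of the Baker–Campbell–Hausdorff series
`Z(X, Y) = log (exp X exp Y)`, in Dynkin's form:
`∑_{k ≥ 1} (-1)^{k-1} / k ∑ [X^{r₁} Y^{s₁} ⋯ X^{r_k} Y^{s_k}] / (d r₁! s₁! ⋯ r_k! s_k!)`,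
where the inner sum is over all `r_i, s_i ≥ 0` with `r_i + s_i > 0` and `∑ (r_i + s_i) = d`. -/
def bchTerm {L : Type*} [LieRing L] [LieAlgebra ℝ L] (d : ℕ) (X Y : L) : L :=
  ∑ k ∈ Finset.Icc 1 d, ((-1 : ℝ) ^ (k - 1) / k) •
    ∑ p ∈ (Fintype.piFinset fun _ : Fin k => Finset.range (d + 1) ×ˢ Finset.range (d + 1)).filter
        (fun p => (∀ i, 0 < (p i).1 + (p i).2) ∧ ∑ i, ((p i).1 + (p i).2) = d),
      ((d : ℝ) * ∏ i, (((p i).1.factorial : ℝ) * ((p i).2.factorial : ℝ)))⁻¹ •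
        nestedLie ((List.ofFn fun i =>
          List.replicate (p i).1 X ++ List.replicate (p i).2 Y).flatten)

/-- The Baker–Campbell–Hausdorff product `Z(X, Y) = X + Y + ½ [X, Y] + ⋯`, for Lie algebras in which
the series terminates. -/
def bch {L : Type*} [LieRing L] [LieAlgebra ℝ L] (X Y : L) : L := ∑ᶠ d : ℕ, bchTerm d X Y

end

end SuperGeom

open SuperGeom

namespace SuperGeom

/-! ### Truncated exponential and logarithm -/

section ExpLog

open Polynomial

attribute [local instance] LieRing.ofAssociativeRing

/-! Nilpotency passes to all `A`-points with the same bound: a nested bracket in `A ⊗ 𝔫` is a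
combination of tensors `a ⊗ v` with `v` a nested bracket in `𝔫` of the same depth
(`foldr_map₂_eq_zero`). Hence `𝔫_A` is nilpotent, and the Dynkin terms vanish beyond a degree that
does not depend on `A`. The product is then a finite sum of iterated brackets: it commutes with Lie
homomorphisms, which gives naturality, and it is `A₀`-smooth because the bracket is `A₀`-bilinear.
Units and inverses only involve commuting elements, for which the product is addition. The substance
is associativity, `NestedVanish.bch_assoc`.

In a nilpotent associative algebra it follows from `exp (bch x y) = exp x * exp y` and the
injectivity of `exp`. To prove this identity, suppose some `δ` satisfies `[δ, x] = x` and `[δ, y] =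
y`, and put `Z = log (exp x exp y)`, `V = exp (ad x) exp (ad y)`. Then `ad Z = log V`. Applied to
`δ`, this expresses `[δ, Z]` as `log V / (V - 1)` applied to `x + exp (ad x) y`. By
`sum_smul_bchTerm` that is also `∑ d • Z_d`, which is `[δ, bch x y]` because `Z_d` has weight `d`.
As `ad δ` is injective on positive weights, `Z = bch x y` (`expN_bch_of_grading`). A suitable `δ`
always exists after adjoining a variable: replace `x`, `y` by `xX`, `yX` and take `δ = X d/dX`;
evaluation at `X = 1` returns to the original algebra (`expN_bch`).

For a nilpotent Lie algebra `L` the adjoint representation loses the centre. The same variable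
repairs this: `G = ℝ[X] ⊗ L` acts on `G × ℝ` as on its semidirect product with the derivation `D = X
d/dX`, by operators generating a nilpotent associative algebra, and the action of `p` determines `D
p`. So associativity holds in `G` after applying `D`, that is, up to constants in `X`. For `X ⊗ x`,
`X ⊗ y`, `X ⊗ z` both sides vanish at `X = 0`, so they agree; now put `X = 1`. -/

/-- The exponential series truncated below degree `N`. -/
noncomputable def expPoly (N : ℕ) : ℝ[X] := ∑ i ∈ Finset.range N, C ((i.factorial : ℝ)⁻¹) * X ^ i

/-- The series `log (1 + X) / X` truncated below degree `N`. -/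
noncomputable def psiPoly (N : ℕ) : ℝ[X] :=
  ∑ k ∈ Finset.range N, C ((-1 : ℝ) ^ k / (k + 1)) * X ^ k

/-- The series `log (1 + X)` truncated at degree `N`. -/
noncomputable def logPoly (N : ℕ) : ℝ[X] := psiPoly N * X

theorem expPoly_succ (N : ℕ) :
    expPoly (N + 1) = expPoly N + C ((N.factorial : ℝ)⁻¹) * X ^ N :=
  Finset.sum_range_succ _ _

theorem derivative_expPoly (N : ℕ) : derivative (expPoly (N + 1)) = expPoly N := by
  rw [expPoly, Finset.sum_range_succ', derivative_add, expPoly, derivative_sum]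
  simp only [derivative_C_mul, derivative_X_pow, pow_zero, mul_one, derivative_C, add_zero]
  refine Finset.sum_congr rfl fun i _ => ?_
  rw [← mul_assoc, ← C_mul, Nat.factorial_succ]
  congr 2
  have : (i.factorial : ℝ) ≠ 0 := by positivity
  push_cast
  field_simp

theorem derivative_logPoly (N : ℕ) :
    derivative (logPoly N) = ∑ k ∈ Finset.range N, (-X : ℝ[X]) ^ k := by
  rw [logPoly, psiPoly, Finset.sum_mul, derivative_sum]
  refine Finset.sum_congr rfl fun k _ => ?_
  rw [mul_assoc, ← pow_succ, derivative_C_mul, derivative_X_pow, ← mul_assoc, ← C_mul,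
    neg_pow (X : ℝ[X])]
  have : ((k : ℝ) + 1) ≠ 0 := by positivity
  push_cast
  rw [div_mul_cancel₀ _ this]
  simp

theorem one_add_X_mul_derivative_logPoly (N : ℕ) :
    (1 + X) * derivative (logPoly N) = 1 - (-X) ^ N := by
  rw [derivative_logPoly, ← mul_neg_geom_sum, sub_neg_eq_add]

theorem X_dvd_logPoly (N : ℕ) : (X : ℝ[X]) ∣ logPoly N := dvd_mul_left _ _

theorem X_dvd_expPoly_sub_one (N : ℕ) : (X : ℝ[X]) ∣ expPoly (N + 1) - 1 := by
  rw [X_dvd_iff, expPoly, Finset.sum_range_succ']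
  simp [coeff_zero_eq_eval_zero, eval_finsetSum]

theorem X_pow_succ_dvd_of_derivative {M : ℕ} {f : ℝ[X]} (h₀ : f.coeff 0 = 0)
    (h : X ^ M ∣ derivative f) : X ^ (M + 1) ∣ f := by
  rw [X_pow_dvd_iff] at h ⊢
  rintro (_ | d) hd
  · exact h₀
  · have := h d (by omega)
    rw [coeff_derivative] at this
    exact (mul_eq_zero.mp this).resolve_right (by positivity)

/-- Uniqueness for the equation `(1 + X) f' = f` with `f(0) = 0`, modulo a power of `X`: since `1 +
X` is coprime to `X`, divisibility of `f` by a power of `X` passes to `f'`, and integrating gains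
one more power. -/
theorem X_pow_succ_dvd_of_one_add_X_mul_derivative {M : ℕ} {f : ℝ[X]} (h₀ : f.coeff 0 = 0)
    (h : X ^ M ∣ (1 + X) * derivative f - f) : X ^ (M + 1) ∣ f := by
  have key : ∀ m ≤ M, X ^ (m + 1) ∣ f := by
    intro m
    induction m with
    | zero => intro _; rwa [zero_add, pow_one, X_dvd_iff]
    | succ m ih =>
      intro hm
      refine X_pow_succ_dvd_of_derivative h₀ ?_
      have h1 : X ^ (m + 1) ∣ (1 + X) * derivative f := by
        have := dvd_add ((pow_dvd_pow X hm).trans h) (ih (by omega))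
        rwa [sub_add_cancel] at this
      have hc : IsCoprime (X ^ (m + 1) : ℝ[X]) (1 + X) :=
        IsCoprime.pow_left ⟨-1, 1, by ring⟩
      exact hc.dvd_of_dvd_mul_left h1
  exact key M le_rfl

theorem X_pow_dvd_expPoly_comp_logPoly (N : ℕ) :
    X ^ N ∣ (expPoly N).comp (logPoly N) - 1 - X := by
  obtain _ | M := N
  · simp
  have hl : (logPoly (M + 1)).eval 0 = 0 := by
    rw [← coeff_zero_eq_eval_zero, ← X_dvd_iff]; exact X_dvd_logPoly _
  have he : (expPoly (M + 1)).eval 0 = 1 := by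
    have := X_dvd_expPoly_sub_one M
    rw [X_dvd_iff, coeff_zero_eq_eval_zero, eval_sub, eval_one, sub_eq_zero] at this
    exact this
  refine X_pow_succ_dvd_of_one_add_X_mul_derivative ?_ ?_
  · rw [coeff_zero_eq_eval_zero]
    simp [eval_comp, hl, he]
  · rw [derivative_sub, derivative_sub, derivative_comp, derivative_expPoly, derivative_X,
      derivative_one]
    have h1 := one_add_X_mul_derivative_logPoly (M + 1)
    have h2 := congrArg (fun p => p.comp (logPoly (M + 1))) (expPoly_succ M)
    simp only [add_comp, mul_comp, C_comp, X_pow_comp] at h2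
    -- The two error terms are the tail of the geometric series for the derivative of the logarithm
    -- and the top term of the exponential, lost on differentiating.
    have h3 : (1 + X) * (derivative (logPoly (M + 1)) * (expPoly M).comp (logPoly (M + 1)) - 0 - 1)
        - ((expPoly (M + 1)).comp (logPoly (M + 1)) - 1 - X)
        = X ^ M * ((-1) ^ M * X * (expPoly M).comp (logPoly (M + 1)))
          - C ((M.factorial : ℝ)⁻¹) * logPoly (M + 1) ^ M := by
      rw [h2]
      have h4 : (-X : ℝ[X]) ^ (M + 1) = - ((-1) ^ M * X ^ M * X) := by
        rw [neg_pow, pow_succ, pow_succ]; ring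
      rw [h4] at h1
      linear_combination ((expPoly M).comp (logPoly (M + 1))) * h1
    rw [h3]
    exact dvd_sub (dvd_mul_right _ _)
      (dvd_mul_of_dvd_right (pow_dvd_pow_of_dvd (X_dvd_logPoly _) _) _)

theorem X_pow_dvd_logPoly_comp_expPoly (N : ℕ) :
    X ^ N ∣ (logPoly N).comp (expPoly N - 1) - X := by
  obtain _ | M := N
  · simp
  have hl : (logPoly (M + 1)).eval 0 = 0 := by
    rw [← coeff_zero_eq_eval_zero, ← X_dvd_iff]; exact X_dvd_logPoly _
  have he : (expPoly (M + 1) - 1).eval 0 = 0 := by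
    rw [← coeff_zero_eq_eval_zero, ← X_dvd_iff]; exact X_dvd_expPoly_sub_one _
  refine X_pow_succ_dvd_of_derivative ?_ ?_
  · rw [coeff_zero_eq_eval_zero, eval_sub, eval_comp, he, hl, eval_X, sub_zero]
  · rw [derivative_sub, derivative_comp, derivative_sub, derivative_expPoly, derivative_X,
      derivative_one, sub_zero]
    have h1 := congrArg (fun p => p.comp (expPoly (M + 1) - 1))
      (one_add_X_mul_derivative_logPoly (M + 1))
    simp only [mul_comp, add_comp, sub_comp, one_comp, X_comp, pow_comp, neg_comp] at h1
    have h2 := expPoly_succ M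
    set D := (derivative (logPoly (M + 1))).comp (expPoly (M + 1) - 1)
    have h3 : expPoly M * D - 1 = - (-(expPoly (M + 1) - 1)) ^ (M + 1)
        - X ^ M * (C ((M.factorial : ℝ)⁻¹) * D) := by
      linear_combination h1 + (-D) * h2
    rw [h3]
    refine dvd_sub ((dvd_neg).mpr ?_) (dvd_mul_right _ _)
    exact (pow_dvd_pow _ M.le_succ).trans
      (pow_dvd_pow_of_dvd ((dvd_neg).mpr (X_dvd_expPoly_sub_one M)) _)

variable {A : Type*} [Ring A] [Algebra ℝ A]

/-- The exponential `∑_{i < N} aⁱ / i!`, for elements with `a ^ N = 0`. -/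
noncomputable def expN (N : ℕ) (a : A) : A := aeval a (expPoly N)

/-- The logarithm of `1 + a`, for elements with `a ^ N = 0`. -/
noncomputable def logN (N : ℕ) (a : A) : A := aeval a (logPoly N)

theorem expN_eq_sum (N : ℕ) (a : A) :
    expN N a = ∑ i ∈ Finset.range N, (i.factorial : ℝ)⁻¹ • a ^ i := by
  simp [expN, expPoly, map_sum, Algebra.smul_def]

theorem aeval_psiPoly (N : ℕ) (a : A) :
    aeval a (psiPoly N) = ∑ k ∈ Finset.range N, ((-1 : ℝ) ^ k / (k + 1)) • a ^ k := by
  simp only [psiPoly, map_sum, map_mul, aeval_C, aeval_X, map_pow, Algebra.smul_def]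

theorem logN_eq (N : ℕ) (a : A) : logN N a = aeval a (psiPoly N) * a := by
  rw [logN, logPoly, map_mul, aeval_X]

/-- Turns congruences of real polynomials modulo `X ^ N` into exact identities for elements with `a
^ N = 0`. -/
theorem aeval_eq_zero_of_X_pow_dvd {N : ℕ} {a : A} (ha : a ^ N = 0) {p : ℝ[X]} (h : X ^ N ∣ p) :
    aeval a p = 0 := by
  obtain ⟨q, rfl⟩ := h
  rw [map_mul, map_pow, aeval_X, ha, zero_mul]

theorem expN_logN {N : ℕ} {a : A} (ha : a ^ N = 0) : expN N (logN N a) = 1 + a := by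
  have h := aeval_eq_zero_of_X_pow_dvd ha (X_pow_dvd_expPoly_comp_logPoly N)
  rw [map_sub, map_sub, aeval_comp, aeval_X, map_one] at h
  rw [expN, logN, sub_eq_iff_eq_add.mp (sub_eq_zero.mp h), add_comm]

theorem logN_expN {N : ℕ} {a : A} (ha : a ^ N = 0) : logN N (expN N a - 1) = a := by
  have h := aeval_eq_zero_of_X_pow_dvd ha (X_pow_dvd_logPoly_comp_expPoly N)
  rw [map_sub, aeval_comp, map_sub, aeval_X, map_one, sub_eq_zero] at h
  exact h

theorem map_expN {B : Type*} [Ring B] [Algebra ℝ B] (f : A →ₐ[ℝ] B) (N : ℕ) (a : A) :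
    f (expN N a) = expN N (f a) := (aeval_algHom_apply f a _).symm

theorem expN_injOn {N : ℕ} {a b : A} (ha : a ^ N = 0) (hb : b ^ N = 0)
    (h : expN N a = expN N b) : a = b := by
  rw [← logN_expN ha, h, logN_expN hb]

theorem expN_add {N : ℕ} {a b : A} (hab : Commute a b) (ha : a ^ N = 0) (hb : b ^ N = 0)
    (hab' : (a + b) ^ N = 0) : expN N (a + b) = expN N a * expN N b := by
  -- `IsNilpotent.exp` is defined over `ℚ`; restricting scalars makes its addition theorem
  -- available.
  let _ : Module ℚ A := Module.compHom A (algebraMap ℚ ℝ)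
  have key : ∀ c : A, c ^ N = 0 → expN N c = IsNilpotent.exp c := by
    intro c hc
    rw [IsNilpotent.exp_eq_sum hc, expN_eq_sum]
    refine Finset.sum_congr rfl fun i _ => ?_
    change _ = (algebraMap ℚ ℝ (i.factorial : ℚ)⁻¹) • c ^ i
    simp
  rw [key _ ha, key _ hb, key _ hab', IsNilpotent.exp_add_of_commute hab ⟨N, ha⟩ ⟨N, hb⟩]

@[simp] theorem expN_zero (N : ℕ) : expN (N + 1) (0 : A) = 1 := by
  rw [expN_eq_sum, Finset.sum_range_succ']
  simp

theorem expN_mul_expN_neg {N : ℕ} {a : A} (ha : a ^ N = 0) : expN N a * expN N (-a) = 1 := by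
  obtain _ | N := N
  -- For `N = 0` the hypothesis reads `1 = 0`, so the ring is trivial.
  · have h : (1 : A) = 0 := by simpa using ha
    rw [← mul_one (expN 0 a * expN 0 (-a)), h, mul_zero]
  rw [← expN_add (Commute.neg_right rfl) ha (by rw [neg_pow, ha, mul_zero]) (by simp),
    add_neg_cancel, expN_zero]

theorem expN_mulLeft (N : ℕ) (a : A) :
    expN N (LinearMap.mulLeft ℝ a) = LinearMap.mulLeft ℝ (expN N a) :=
  (map_expN (Algebra.lmul ℝ A) N a).symm

/-- Right multiplication reverses products, so `map_expN` does not apply; powers of a single element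
are insensitive to the reversal. -/
theorem expN_mulRight (N : ℕ) (a : A) :
    expN N (LinearMap.mulRight ℝ a) = LinearMap.mulRight ℝ (expN N a) := by
  ext b
  simp [expN_eq_sum, LinearMap.sum_apply, Finset.mul_sum, LinearMap.pow_mulRight]

theorem ad_pow_eq_zero {N : ℕ} {a : A} (ha : a ^ N = 0) : LieAlgebra.ad ℝ A a ^ (2 * N) = 0 := by
  rw [LieAlgebra.ad_eq_lmul_left_sub_lmul_right, Pi.sub_apply, sub_eq_add_neg]
  refine Commute.add_pow_eq_zero_of_add_le_succ_of_pow_eq_zero (m := N) (n := N)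
    (LinearMap.commute_mulLeft_right (R := ℝ) a a).neg_right ?_ ?_ (by omega)
  · rw [LinearMap.pow_mulLeft, ha, LinearMap.mulLeft_zero_eq_zero]
  · rw [neg_pow, LinearMap.pow_mulRight, ha, LinearMap.mulRight_zero_eq_zero, mul_zero]

/-- `ad a` is the sum of the commuting operators of left multiplication by `a` and right
multiplication by `-a`. The exponent doubles because `ad a` is a sum of two commuting operators with
vanishing `N`-th powers. -/
theorem expN_ad_apply {N : ℕ} {a : A} (ha : a ^ N = 0) (b : A) :
    expN (2 * N) (LieAlgebra.ad ℝ A a) b = expN (2 * N) a * b * expN (2 * N) (-a) := by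
  have ha' : a ^ (2 * N) = 0 := pow_eq_zero_of_le (by omega) ha
  have h := ad_pow_eq_zero ha
  have e : LieAlgebra.ad ℝ A a = LinearMap.mulLeft ℝ a + LinearMap.mulRight ℝ (-a) := by
    rw [LieAlgebra.ad_eq_lmul_left_sub_lmul_right, Pi.sub_apply, sub_eq_add_neg]
    ext; simp
  rw [e] at h ⊢
  rw [expN_add (LinearMap.commute_mulLeft_right (R := ℝ) a (-a)) _ _ h, expN_mulLeft, expN_mulRight]
  · simp [mul_assoc]
  · rw [LinearMap.pow_mulLeft, ha', LinearMap.mulLeft_zero_eq_zero]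
  · rw [LinearMap.pow_mulRight, neg_pow, ha', mul_zero, LinearMap.mulRight_zero_eq_zero]

end ExpLog

/-! ### Dynkin's series in terms of the adjoint action -/

section Dynkin

variable {L : Type*}

/-- The tail must be nonempty: the empty word has value `0`, so for `l = [a]`, `m = []` the left
side is `a` and the right side `⁅a, 0⁆`. -/
theorem nestedLie_append [LieRing L] (l : List L) {m : List L} (hm : m ≠ []) :
    nestedLie (l ++ m) = l.foldr (fun a b => ⁅a, b⁆) (nestedLie m) := by
  induction l with
  | nil => rfl
  | cons a l ih =>
    obtain ⟨b, t, hbt⟩ := List.exists_cons_of_ne_nil (l := l ++ m) (by simp [hm])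
    rw [List.cons_append, List.foldr_cons, ← ih, hbt, nestedLie]

/-- The word `X^{r₁} Y^{s₁} ⋯ X^{r_k} Y^{s_k}`. -/
def blockWord {k : ℕ} (x y : L) (p : Fin k → ℕ × ℕ) : List L :=
  (List.ofFn fun i => List.replicate (p i).1 x ++ List.replicate (p i).2 y).flatten

theorem length_blockWord {k : ℕ} (x y : L) (p : Fin k → ℕ × ℕ) :
    (blockWord x y p).length = ∑ i, ((p i).1 + (p i).2) := by
  simp [blockWord, List.length_flatten, List.map_ofFn, List.sum_ofFn, Function.comp_def]

theorem mem_blockWord {k : ℕ} {x y z : L} {p : Fin k → ℕ × ℕ} (h : z ∈ blockWord x y p) :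
    z = x ∨ z = y := by
  simp only [blockWord, List.mem_flatten, List.mem_ofFn, exists_exists_eq_and, List.mem_append,
    List.mem_replicate] at h
  obtain ⟨i, h | h⟩ := h
  · exact Or.inl h.2
  · exact Or.inr h.2

theorem blockWord_cons {k : ℕ} (x y : L) (a : ℕ × ℕ) (p : Fin k → ℕ × ℕ) :
    blockWord x y (Fin.cons a p : Fin (k + 1) → ℕ × ℕ)
      = List.replicate a.1 x ++ List.replicate a.2 y ++ blockWord x y p := by
  simp [blockWord, List.ofFn_succ]

theorem sum_piFinset_cons {M : Type*} [AddCommMonoid M] {α : Type*} [DecidableEq α] {k : ℕ}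
    (s : Finset α) (f : (Fin (k + 1) → α) → M) :
    ∑ p ∈ Fintype.piFinset (fun _ : Fin (k + 1) => s), f p
      = ∑ a ∈ s, ∑ q ∈ Fintype.piFinset (fun _ : Fin k => s), f (Fin.cons a q) := by
  rw [← Finset.sum_product']
  refine (Finset.sum_equiv (Fin.consEquiv fun _ => α) (fun p => ?_) fun p _ => rfl).symm
  simp [Fin.consEquiv, Fintype.mem_piFinset, Fin.forall_fin_succ]

variable [LieRing L] [LieAlgebra ℝ L]

theorem foldr_replicate_lie (x z : L) (r : ℕ) :
    (List.replicate r x).foldr (fun a b => ⁅a, b⁆) z = (LieAlgebra.ad ℝ L x ^ r) z := by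
  induction r with
  | zero => rfl
  | succ r ih => rw [List.replicate_succ, List.foldr_cons, ih, pow_succ']; rfl

/-- The pairs `(r, s) ≠ (0, 0)` with `r, s < P`. -/
def posBox (P : ℕ) : Finset (ℕ × ℕ) :=
  (Finset.range P ×ˢ Finset.range P).filter fun a => 0 < a.1 + a.2

/-- The contribution of `k` blocks to Dynkin's series. -/
noncomputable def blockSum (P k : ℕ) (x y : L) : L :=
  ∑ p ∈ Fintype.piFinset (fun _ : Fin k => posBox P),
    (∏ i, (((p i).1.factorial : ℝ) * ((p i).2.factorial : ℝ)))⁻¹ • nestedLie (blockWord x y p)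

theorem expN_mul_expN_sub_one {A : Type*} [Ring A] [Algebra ℝ A] (P : ℕ) (a b : A) :
    expN (P + 1) a * expN (P + 1) b - 1 = ∑ c ∈ posBox (P + 1),
      ((c.1.factorial : ℝ) * (c.2.factorial : ℝ))⁻¹ • (a ^ c.1 * b ^ c.2) := by
  rw [sub_eq_iff_eq_add, expN_eq_sum, expN_eq_sum, Finset.sum_mul_sum, ← Finset.sum_product']
  rw [← Finset.sum_filter_add_sum_filter_not _ (fun c : ℕ × ℕ => 0 < c.1 + c.2)]
  congr 1
  · refine Finset.sum_congr rfl fun c _ => ?_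
    rw [smul_mul_smul_comm, mul_inv]
  · have h : ((Finset.range (P + 1) ×ˢ Finset.range (P + 1)).filter
        fun c : ℕ × ℕ => ¬ 0 < c.1 + c.2) = {(0, 0)} := by
      ext ⟨r, s⟩
      simp only [Finset.mem_filter, Finset.mem_product, Finset.mem_range, Finset.mem_singleton,
        Prod.mk.injEq]
      omega
    rw [h, Finset.sum_singleton]
    simp

/-- Summing over the first block `X^r Y^s` with weight `1 / (r! s!)` applies `exp (ad x) exp (ad y)`
to the rest, and excluding `(0, 0)` subtracts the identity. At least one further block is needed,
since `nestedLie_append` requires a nonempty tail. -/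
theorem blockSum_succ_succ (P k : ℕ) (x y : L) :
    blockSum (P + 1) (k + 2) x y
      = (expN (P + 1) (LieAlgebra.ad ℝ L x) * expN (P + 1) (LieAlgebra.ad ℝ L y) - 1)
        (blockSum (P + 1) (k + 1) x y) := by
  rw [blockSum, sum_piFinset_cons, expN_mul_expN_sub_one, LinearMap.sum_apply]
  refine Finset.sum_congr rfl fun a _ => ?_
  rw [blockSum, map_sum]
  refine Finset.sum_congr rfl fun q hq => ?_
  have hne : blockWord x y q ≠ [] := by
    rw [← List.length_pos_iff, length_blockWord]
    have h0 := Fintype.mem_piFinset.mp hq 0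
    exact Finset.sum_pos' (fun _ _ => Nat.zero_le _) ⟨0, Finset.mem_univ _,
      (Finset.mem_filter.mp h0).2⟩
  rw [blockWord_cons, List.append_assoc, nestedLie_append _ (by simp [hne]),
    nestedLie_append _ hne, foldr_replicate_lie, foldr_replicate_lie, Fin.prod_univ_succ]
  simp only [Fin.cons_zero, Fin.cons_succ, LinearMap.smul_apply, Module.End.mul_apply, map_smul]
  rw [smul_smul, mul_inv, mul_comm]

theorem nestedLie_block (x y : L) (r s : ℕ) :
    nestedLie (List.replicate r x ++ List.replicate s y)
      = if s = 1 then (LieAlgebra.ad ℝ L x ^ r) y else if s = 0 ∧ r = 1 then x else 0 := by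
  have aux : ∀ (z : L) (s : ℕ), nestedLie (List.replicate s z) = if s = 1 then z else 0 := by
    rintro z (_ | _ | s)
    · rfl
    · rfl
    · rw [if_neg (by omega)]
      induction s with
      | zero => exact lie_self z
      | succ s ih =>
        change ⁅z, nestedLie (List.replicate (s + 2) z)⁆ = 0
        rw [ih, lie_zero]
  rcases Nat.eq_zero_or_pos s with rfl | hs
  · simp [aux]
  · rw [nestedLie_append _ (by simp; omega), foldr_replicate_lie, aux]
    by_cases h : s = 1
    · simp [h]
    · simp [h, hs.ne']

/-- In a single block two equal letters at the end kill the bracket, so only `X^r Y` and `X`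
survive. The box bound is at least `2` so that it contains the exponent `1`. -/
theorem blockSum_one (P : ℕ) (x y : L) :
    blockSum (P + 2) 1 x y = x + expN (P + 2) (LieAlgebra.ad ℝ L x) y := by
  rw [blockSum, sum_piFinset_cons, expN_eq_sum, LinearMap.sum_apply, posBox,
    Finset.sum_filter_of_ne, Finset.sum_product_right]
  · have hk : ∀ r s : ℕ, (∑ q ∈ Fintype.piFinset (fun _ : Fin 0 => posBox (P + 2)),
        (∏ i, ((((Fin.cons (r, s) q : Fin 1 → ℕ × ℕ) i).1.factorial : ℝ)
          * (((Fin.cons (r, s) q : Fin 1 → ℕ × ℕ) i).2.factorial : ℝ)))⁻¹ •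
          nestedLie (blockWord x y (Fin.cons (r, s) q : Fin 1 → ℕ × ℕ)))
        = ((r.factorial : ℝ) * (s.factorial : ℝ))⁻¹ •
          nestedLie (List.replicate r x ++ List.replicate s y) := by
      intro r s
      simp [blockWord]
    simp only [posBox] at hk
    simp only [hk, nestedLie_block]
    rw [Finset.sum_range_succ', Finset.sum_range_succ', add_comm]
    congr 1
    · rw [Finset.sum_eq_single 1] <;> simp +contextual
    · rw [Finset.sum_eq_zero, zero_add]
      · simp
      · intro s _
        simp
  -- Positivity of the block may be dropped here: the pair `(0, 0)` gives the empty word, whose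
  -- value is `0`.
  · rintro ⟨r, s⟩ _ h
    by_contra h0
    obtain ⟨rfl, rfl⟩ : r = 0 ∧ s = 0 := by simp only [not_lt] at h0; omega
    simp [blockWord, nestedLie] at h

theorem blockSum_succ (P k : ℕ) (x y : L) :
    blockSum (P + 2) (k + 1) x y
      = ((expN (P + 2) (LieAlgebra.ad ℝ L x) * expN (P + 2) (LieAlgebra.ad ℝ L y) - 1) ^ k)
        (x + expN (P + 2) (LieAlgebra.ad ℝ L x) y) := by
  induction k with
  | zero => rw [blockSum_one]; rfl
  | succ k ih => rw [blockSum_succ_succ, ih, pow_succ', Module.End.mul_apply]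

/-- The factor `d` cancels the `1/d` in Dynkin's formula. Nonempty blocks of total length `d` fit in
any box larger than `d` and number at most `d`, so one box and one range of `k` serve all degrees
below `P`. -/
theorem smul_bchTerm (P d : ℕ) (hd : d < P) (x y : L) :
    (d : ℝ) • bchTerm d x y = ∑ k ∈ Finset.range P, ((-1 : ℝ) ^ k / (k + 1)) •
      ∑ p ∈ (Fintype.piFinset fun _ : Fin (k + 1) => posBox P).filter
          (fun p => (blockWord x y p).length = d),
        (∏ i, (((p i).1.factorial : ℝ) * ((p i).2.factorial : ℝ)))⁻¹ •
          nestedLie (blockWord x y p) := by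
  have hset : ∀ k : ℕ, ((Fintype.piFinset fun _ : Fin k =>
        Finset.range (d + 1) ×ˢ Finset.range (d + 1)).filter
        (fun p => (∀ i, 0 < (p i).1 + (p i).2) ∧ ∑ i, ((p i).1 + (p i).2) = d))
      = (Fintype.piFinset fun _ : Fin k => posBox P).filter
          (fun p => (blockWord x y p).length = d) := by
    intro k
    ext p
    simp only [Finset.mem_filter, Fintype.mem_piFinset, posBox, Finset.mem_product,
      Finset.mem_range, length_blockWord]
    constructor
    · rintro ⟨h1, h2, h3⟩
      exact ⟨fun i => ⟨⟨by have := (h1 i).1; omega, by have := (h1 i).2; omega⟩, h2 i⟩, h3⟩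
    · rintro ⟨h1, h3⟩
      have h : ∀ i, (p i).1 + (p i).2 ≤ d := fun i => h3 ▸
        Finset.single_le_sum (f := fun i => (p i).1 + (p i).2) (fun _ _ => Nat.zero_le _)
          (Finset.mem_univ i)
      exact ⟨fun i => ⟨by have := h i; omega, by have := h i; omega⟩, fun i => (h1 i).2, h3⟩
  have hempty : ∀ k : ℕ, d < k → ((Fintype.piFinset fun _ : Fin k => posBox P).filter
      (fun p => (blockWord x y p).length = d)) = ∅ := by
    intro k hk
    rw [Finset.filter_eq_empty_iff]
    intro p hp hlen
    rw [length_blockWord] at hlen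
    have : ∑ i : Fin k, 1 ≤ ∑ i, ((p i).1 + (p i).2) := Finset.sum_le_sum fun i _ =>
      (Finset.mem_filter.mp (Fintype.mem_piFinset.mp hp i)).2
    simp at this
    omega
  set f : ℕ → L := fun k => ((-1 : ℝ) ^ (k - 1) / k) •
    ∑ p ∈ (Fintype.piFinset fun _ : Fin k => posBox P).filter
      (fun p => (blockWord x y p).length = d),
      (∏ i, (((p i).1.factorial : ℝ) * ((p i).2.factorial : ℝ)))⁻¹ •
          nestedLie (blockWord x y p) with hf
  have hl : (d : ℝ) • bchTerm d x y = ∑ k ∈ Finset.Icc 1 d, f k := by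
    rw [bchTerm, Finset.smul_sum]
    refine Finset.sum_congr rfl fun k hk => ?_
    have hd0 : (d : ℝ) ≠ 0 := by
      have := Finset.mem_Icc.mp hk
      exact_mod_cast (by omega : d ≠ 0)
    rw [hset, smul_comm, Finset.smul_sum]
    refine congrArg _ (Finset.sum_congr rfl fun p _ => ?_)
    rw [smul_smul, mul_inv, ← mul_assoc, mul_inv_cancel₀ hd0, one_mul]
    rfl
  have hr : ∑ k ∈ Finset.range P, f (k + 1) = ∑ k ∈ Finset.Icc 1 d, f k := by
    rw [Finset.range_eq_Ico, Finset.sum_Ico_add' f 0 P 1]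
    refine (Finset.sum_subset (fun k hk => ?_) fun k hk hk' => ?_).symm
    · simp only [Finset.mem_Icc, Finset.mem_Ico] at hk ⊢; omega
    · simp only [Finset.mem_Icc, Finset.mem_Ico] at hk hk'
      rw [hf]
      simp only
      rw [hempty k (by omega), Finset.sum_empty, smul_zero]
  rw [hl, ← hr]
  simp [hf]

/-- Dynkin's formula sums up to `log V / (V - 1)` applied to `x + exp (ad x) y`, where
`V = exp (ad x) exp (ad y)`. -/
theorem sum_smul_bchTerm (P : ℕ) (x y : L)
    (hP : ∀ w : List L, (∀ z ∈ w, z = x ∨ z = y) → P + 2 ≤ w.length → nestedLie w = 0) :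
    ∑ d ∈ Finset.range (P + 2), (d : ℝ) • bchTerm d x y
      = Polynomial.aeval
          (expN (P + 2) (LieAlgebra.ad ℝ L x) * expN (P + 2) (LieAlgebra.ad ℝ L y) - 1)
          (psiPoly (P + 2)) (x + expN (P + 2) (LieAlgebra.ad ℝ L x) y) := by
  rw [aeval_psiPoly, LinearMap.sum_apply,
    Finset.sum_congr rfl fun d hd => smul_bchTerm (P + 2) d (Finset.mem_range.mp hd) x y,
    Finset.sum_comm]
  refine Finset.sum_congr rfl fun k _ => ?_
  rw [LinearMap.smul_apply, ← blockSum_succ, ← Finset.smul_sum, blockSum,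
    Finset.sum_fiberwise_eq_sum_filter, Finset.sum_filter_of_ne]
  -- The sum over all blocks in the box also contains words of degree at least `P + 2`; these vanish
  -- by hypothesis.
  intro p _ hne
  by_contra h
  refine hne ?_
  rw [hP _ (fun z hz => mem_blockWord hz) (by simpa using h), smul_zero]

/-- A submodule containing the brackets of all words of length `d` contains the degree `d` term. -/
theorem bchTerm_mem {d : ℕ} {x y : L} (S : Submodule ℝ L)
    (h : ∀ w : List L, (∀ z ∈ w, z = x ∨ z = y) → w.length = d → nestedLie w ∈ S) :
    bchTerm d x y ∈ S := by
  rw [bchTerm]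
  refine Submodule.sum_mem _ fun k _ => Submodule.smul_mem _ _ <| Submodule.sum_mem _ fun p hp =>
    Submodule.smul_mem _ _ <| h (blockWord x y p) (fun z hz => mem_blockWord hz) ?_
  rw [length_blockWord]
  exact (Finset.mem_filter.mp hp).2.2

/-- The terms of the series of high degree vanish as soon as the long brackets do. -/
theorem bchTerm_eq_zero {d : ℕ} {x y : L}
    (h : ∀ w : List L, (∀ z ∈ w, z = x ∨ z = y) → w.length = d → nestedLie w = 0) :
    bchTerm d x y = 0 :=
  (Submodule.mem_bot ℝ).mp (bchTerm_mem ⊥ h)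

theorem map_nestedLie {L' : Type*} [LieRing L'] [LieAlgebra ℝ L'] (f : L →ₗ⁅ℝ⁆ L') (w : List L) :
    f (nestedLie w) = nestedLie (w.map f) := by
  induction w with
  | nil => exact map_zero f
  | cons a w ih =>
    obtain _ | ⟨b, w⟩ := w
    · rfl
    · change f ⁅a, nestedLie (b :: w)⁆ = _
      rw [LieHom.map_lie, ih]
      rfl

theorem map_bchTerm {L' : Type*} [LieRing L'] [LieAlgebra ℝ L'] (f : L →ₗ⁅ℝ⁆ L') (d : ℕ)
    (x y : L) : f (bchTerm d x y) = bchTerm d (f x) (f y) := by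
  simp only [bchTerm, map_sum, map_smul, map_nestedLie, List.map_flatten, List.map_ofFn,
    Function.comp_def, List.map_append, List.map_replicate]

theorem bch_eq_sum {N : ℕ} {x y : L} (h : ∀ d, N ≤ d → bchTerm d x y = 0) :
    bch x y = ∑ d ∈ Finset.range N, bchTerm d x y := by
  refine finsum_eq_sum_of_support_subset _ fun d hd => ?_
  by_contra hd'
  exact hd (h d (by simpa using hd'))

/-- `bch` is a `finsum`, so termination must be known before `f` can be applied termwise;
termination on the target side then follows by applying `f`. -/
theorem map_bch {L' : Type*} [LieRing L'] [LieAlgebra ℝ L'] (f : L →ₗ⁅ℝ⁆ L') {N : ℕ} {x y : L}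
    (h : ∀ d, N ≤ d → bchTerm d x y = 0) : f (bch x y) = bch (f x) (f y) := by
  rw [bch_eq_sum h, bch_eq_sum (N := N), map_sum]
  · simp only [map_bchTerm]
  · intro d hd
    rw [← map_bchTerm, h d hd, map_zero]

end Dynkin

/-! ### The Baker–Campbell–Hausdorff formula in nilpotent associative algebras -/

section Associative

open Polynomial

attribute [local instance] LieRing.ofAssociativeRing

variable {B : Type*} [Ring B] [Algebra ℝ B] {Q : Submodule ℝ B}

theorem pow_eq_zero_of_mem {N : ℕ} (hN : Q ^ N = ⊥) {a : B} (ha : a ∈ Q) : a ^ N = 0 := by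
  have := Submodule.pow_mem_pow Q ha N
  rwa [hN, Submodule.mem_bot] at this

theorem aeval_mem_of_X_dvd (hQ : Q * Q ≤ Q) {a : B} (ha : a ∈ Q) {p : ℝ[X]} (hp : X ∣ p) :
    aeval a p ∈ Q := by
  obtain ⟨q, rfl⟩ := hp
  rw [map_mul, aeval_X]
  induction q using Polynomial.induction_on with
  | C r => rw [aeval_C, ← Algebra.commutes, ← Algebra.smul_def]; exact Q.smul_mem r ha
  | add p q hp hq => rw [map_add, mul_add]; exact add_mem hp hq
  | monomial n r h =>
    rw [pow_succ, ← mul_assoc, map_mul, aeval_X, ← mul_assoc]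
    exact hQ (Submodule.mul_mem_mul h ha)

theorem expN_sub_one_mem (hQ : Q * Q ≤ Q) {a : B} (ha : a ∈ Q) (N : ℕ) :
    expN (N + 1) a - 1 ∈ Q := by
  have := aeval_mem_of_X_dvd hQ ha (X_dvd_expPoly_sub_one N)
  rwa [map_sub, map_one] at this

theorem expN_mul_expN_sub_one_mem (hQ : Q * Q ≤ Q) {a b : B} (ha : a ∈ Q) (hb : b ∈ Q) (N : ℕ) :
    expN (N + 1) a * expN (N + 1) b - 1 ∈ Q := by
  have h1 := expN_sub_one_mem hQ ha N
  have h2 := expN_sub_one_mem hQ hb N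
  have e : expN (N + 1) a * expN (N + 1) b - 1 = (expN (N + 1) a - 1) * (expN (N + 1) b - 1)
      + (expN (N + 1) a - 1) + (expN (N + 1) b - 1) := by noncomm_ring
  rw [e]
  exact add_mem (add_mem (hQ (Submodule.mul_mem_mul h1 h2)) h1) h2

theorem nestedLie_mem_pow (w : List B) (hw : ∀ z ∈ w, z ∈ Q) : nestedLie w ∈ Q ^ w.length := by
  induction w with
  | nil => exact zero_mem _
  | cons a w ih =>
    obtain _ | ⟨b, w⟩ := w
    · simpa [nestedLie] using hw
    · change ⁅a, nestedLie (b :: w)⁆ ∈ Q ^ ((b :: w).length + 1)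
      have ha := hw a (by simp)
      have h := ih fun z hz => hw z (by simp [hz])
      rw [LieRing.of_associative_ring_bracket]
      refine sub_mem ?_ ?_
      · rw [pow_succ']; exact Submodule.mul_mem_mul ha h
      · rw [pow_succ]; exact Submodule.mul_mem_mul h ha

theorem nestedLie_eq_zero_of_pow {N : ℕ} (hN : Q ^ N = ⊥) (w : List B) (hw : ∀ z ∈ w, z ∈ Q)
    (hl : N ≤ w.length) : nestedLie w = 0 := by
  have h := nestedLie_mem_pow w hw
  rw [← Nat.add_sub_cancel' hl, pow_add, hN, Submodule.bot_mul, Submodule.mem_bot] at h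
  exact h

theorem bchTerm_eq_zero_of_pow {N : ℕ} (hN : Q ^ N = ⊥) {x y : B} (hx : x ∈ Q) (hy : y ∈ Q) {d : ℕ}
    (hd : N ≤ d) : bchTerm d x y = 0 :=
  bchTerm_eq_zero fun w hw hl => nestedLie_eq_zero_of_pow hN w
    (fun z hz => by rcases hw z hz with rfl | rfl <;> assumption) (hl ▸ hd)

theorem nestedLie_mem_of_mul (hQ : Q * Q ≤ Q) (w : List B) (hw : ∀ z ∈ w, z ∈ Q) :
    nestedLie w ∈ Q := by
  induction w with
  | nil => exact zero_mem _
  | cons a w ih =>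
    obtain _ | ⟨b, w⟩ := w
    · simpa [nestedLie] using hw
    · change ⁅a, nestedLie (b :: w)⁆ ∈ Q
      have ha := hw a (by simp)
      have h := ih fun z hz => hw z (by simp [hz])
      exact sub_mem (hQ (Submodule.mul_mem_mul ha h)) (hQ (Submodule.mul_mem_mul h ha))

theorem bch_mem_of_mul (hQ : Q * Q ≤ Q) {N : ℕ} (hN : Q ^ N = ⊥) {x y : B} (hx : x ∈ Q)
    (hy : y ∈ Q) : bch x y ∈ Q := by
  rw [bch_eq_sum fun d hd => bchTerm_eq_zero_of_pow hN hx hy hd]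
  exact sum_mem fun d _ => bchTerm_mem Q fun w hw _ => nestedLie_mem_of_mul hQ w
    fun z hz => by rcases hw z hz with rfl | rfl <;> assumption

/-- The elements of positive degree for the grading by the eigenvalues of `ad δ`. -/
noncomputable def positivePart (δ : B) : Submodule ℝ B :=
  ⨆ d : ℕ, Module.End.eigenspace (LieAlgebra.ad ℝ B δ) ((d : ℝ) + 1)

/-- `ad δ` is a derivation, so eigenvalues add under multiplication. -/
theorem positivePart_mul_le (δ : B) : positivePart δ * positivePart δ ≤ positivePart δ := by
  rw [positivePart, Submodule.iSup_mul]
  refine iSup_le fun d => ?_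
  rw [Submodule.mul_iSup]
  refine iSup_le fun e => Submodule.mul_le.mpr fun a ha b hb => ?_
  refine Submodule.mem_iSup_of_mem (d + e + 1) ?_
  rw [Module.End.mem_eigenspace_iff, LieAlgebra.ad_apply,
    LieRing.of_associative_ring_bracket] at *
  have h : δ * (a * b) - a * b * δ = (δ * a - a * δ) * b + a * (δ * b - b * δ) := by noncomm_ring
  rw [h, ha, hb, smul_mul_assoc, mul_smul_comm, ← add_smul]
  congr 1
  push_cast
  ring

theorem mem_positivePart {δ x : B} (h : ⁅δ, x⁆ = x) : x ∈ positivePart δ :=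
  Submodule.mem_iSup_of_mem 0 (by simpa [Module.End.mem_eigenspace_iff] using h)

/-- Eigenspaces for distinct eigenvalues are independent, and `0` is not among the eigenvalues `d +
1`. -/
theorem eq_zero_of_mem_positivePart {δ v : B} (hv : v ∈ positivePart δ) (h : ⁅δ, v⁆ = 0) :
    v = 0 := by
  have hd := Module.End.eigenspaces_iSupIndep (LieAlgebra.ad ℝ B δ) 0
  refine Submodule.disjoint_def.mp hd v ?_ ?_
  · simpa [Module.End.mem_eigenspace_iff] using h
  · refine (iSup_le fun d => ?_ : positivePart δ ≤ _) hv
    exact le_iSup₂_of_le ((d : ℝ) + 1) (by positivity) le_rfl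

theorem lie_bchTerm {δ x y : B} (hx : ⁅δ, x⁆ = x) (hy : ⁅δ, y⁆ = y) (d : ℕ) :
    ⁅δ, bchTerm d x y⁆ = (d : ℝ) • bchTerm d x y := by
  have h : bchTerm d x y ∈ Module.End.eigenspace (LieAlgebra.ad ℝ B δ) (d : ℝ) := by
    refine bchTerm_mem _ fun w hw hl => ?_
    subst hl
    rw [Module.End.mem_eigenspace_iff, LieAlgebra.ad_apply]
    induction w with
    | nil => simp [nestedLie]
    | cons a w ih =>
      have ha : ⁅δ, a⁆ = a := by rcases hw a (by simp) with rfl | rfl <;> assumption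
      obtain _ | ⟨b, w⟩ := w
      · simpa [nestedLie] using ha
      · change ⁅δ, ⁅a, nestedLie (b :: w)⁆⁆ = _ • ⁅a, nestedLie (b :: w)⁆
        rw [leibniz_lie, ha, ih fun z hz => hw z (by simp [hz]), lie_smul, List.length_cons (a := a)]
        push_cast
        rw [add_smul, one_smul, add_comm]
  rwa [Module.End.mem_eigenspace_iff, LieAlgebra.ad_apply] at h

/-- The Baker–Campbell–Hausdorff formula for two elements that are homogeneous of degree one. -/
theorem expN_bch_of_grading (hQ : Q * Q ≤ Q) {N : ℕ} (hN : Q ^ (N + 1) = ⊥) {x y δ : B}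
    (hx : x ∈ Q) (hy : y ∈ Q) (hδx : ⁅δ, x⁆ = x) (hδy : ⁅δ, y⁆ = y) :
    expN (2 * N + 2) (bch x y) = expN (2 * N + 2) x * expN (2 * N + 2) y := by
  -- One truncation order serves both the elements of `Q`, nilpotent of order `N + 1`, and their
  -- adjoint operators, nilpotent of order `2 * (N + 1)`.
  set P := 2 * N + 2 with hP
  have hPN : 2 * (N + 1) = P := rfl
  set E := expN P x * expN P y with hE
  have hu : E - 1 ∈ Q := expN_mul_expN_sub_one_mem hQ hx hy _
  have nil : ∀ a ∈ Q, a ^ P = 0 := fun a ha =>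
    pow_eq_zero_of_le (by omega) (pow_eq_zero_of_mem hN ha)
  set Z := logN P (E - 1) with hZ
  have hZQ : Z ∈ Q := aeval_mem_of_X_dvd hQ hu (X_dvd_logPoly P)
  have hZexp : expN P Z = E := by rw [hZ, expN_logN (nil _ hu), add_sub_cancel]
  suffices h : Z = bch x y by rw [← h, hZexp]
  -- `Z` is a polynomial without constant term in `exp x exp y - 1`, so it stays in any
  -- multiplicatively closed subspace containing `x` and `y`.
  have hZpos : Z ∈ positivePart δ :=
    aeval_mem_of_X_dvd (positivePart_mul_le δ)
      (expN_mul_expN_sub_one_mem (positivePart_mul_le δ) (mem_positivePart hδx)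
        (mem_positivePart hδy) _) (X_dvd_logPoly P)
  have had : ∀ a ∈ Q, ∀ b, expN P (LieAlgebra.ad ℝ B a) b = expN P a * b * expN P (-a) :=
    fun a ha b => expN_ad_apply (pow_eq_zero_of_mem hN ha) b
  have hinv : expN P (-Z) = expN P (-y) * expN P (-x) := by
    have h1 : E * (expN P (-y) * expN P (-x)) = 1 := by
      rw [hE, mul_assoc, ← mul_assoc (expN P y), expN_mul_expN_neg (nil _ hy), one_mul,
        expN_mul_expN_neg (nil _ hx)]
    have h2 : expN P (-Z) * E = 1 := by
      have := expN_mul_expN_neg (nil _ (neg_mem hZQ))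
      rwa [neg_neg, hZexp] at this
    exact left_inv_eq_right_inv h2 h1
  set V := expN P (LieAlgebra.ad ℝ B x) * expN P (LieAlgebra.ad ℝ B y) with hV
  have hadZ : expN P (LieAlgebra.ad ℝ B Z) = V := by
    ext b
    rw [had Z hZQ, hZexp, hinv, hV, Module.End.mul_apply, had y hy, had x hx, hE]
    simp only [mul_assoc]
  have hadlog : LieAlgebra.ad ℝ B Z = logN P (V - 1) := by
    rw [← hadZ, ← hPN, logN_expN (ad_pow_eq_zero (pow_eq_zero_of_mem hN hZQ))]
  have hyδ : LieAlgebra.ad ℝ B y δ = -y := by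
    rw [LieAlgebra.ad_apply, ← lie_skew, hδy]
  have hxδ : LieAlgebra.ad ℝ B x δ = -x := by
    rw [LieAlgebra.ad_apply, ← lie_skew, hδx]
  -- The series stops after the linear term, since `(ad a)² δ = -[a, a] = 0`.
  have hexpδ : ∀ a : B, LieAlgebra.ad ℝ B a δ = -a →
      expN P (LieAlgebra.ad ℝ B a) δ = δ - a := by
    intro a ha
    rw [hP, expN_eq_sum, LinearMap.sum_apply, Finset.sum_range_succ', Finset.sum_range_succ',
      Finset.sum_eq_zero]
    · simp [ha, sub_eq_neg_add]
    · intro i _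
      rw [pow_add, LinearMap.smul_apply, Module.End.mul_apply, pow_one, ha, map_neg,
        pow_succ, Module.End.mul_apply]
      simp
  have hVδ : (V - 1) δ = -(x + expN P (LieAlgebra.ad ℝ B x) y) := by
    rw [LinearMap.sub_apply, hV, Module.End.mul_apply, hexpδ y hyδ, map_sub, hexpδ x hxδ,
      Module.End.one_apply]
    abel
  -- `log V` is `psiPoly` at `V - 1` composed with `V - 1`, and the inner factor has just been
  -- evaluated on `δ`.
  have hδZ : ⁅δ, Z⁆ = aeval (V - 1) (psiPoly P) (x + expN P (LieAlgebra.ad ℝ B x) y) := by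
    rw [← lie_skew, ← LieAlgebra.ad_apply (R := ℝ), hadlog, logN_eq, Module.End.mul_apply, hVδ,
      map_neg, neg_neg]
  have hword : ∀ w : List B, (∀ z ∈ w, z = x ∨ z = y) → ∀ z ∈ w, z ∈ Q := fun w hw z hz => by
    rcases hw z hz with rfl | rfl <;> assumption
  have hbch : bch x y = ∑ d ∈ Finset.range P, bchTerm d x y :=
    bch_eq_sum fun d hd => bchTerm_eq_zero_of_pow hN hx hy (by omega)
  have hδbch : ⁅δ, bch x y⁆ = ⁅δ, Z⁆ := by
    rw [hδZ, hV, hP, ← sum_smul_bchTerm (2 * N) x y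
      fun w hw hl => nestedLie_eq_zero_of_pow hN w (hword w hw) (by omega), hbch, lie_sum]
    exact Finset.sum_congr rfl fun d _ => lie_bchTerm hδx hδy d
  have hbchpos : bch x y ∈ positivePart δ := by
    rw [hbch]
    refine sum_mem fun d _ => bchTerm_mem _ fun w hw _ =>
      nestedLie_mem_of_mul (positivePart_mul_le δ) w fun z hz => ?_
    rcases hw z hz with rfl | rfl
    exacts [mem_positivePart hδx, mem_positivePart hδy]
  refine sub_eq_zero.mp (eq_zero_of_mem_positivePart (sub_mem hZpos hbchpos) ?_)
  rw [lie_sub, hδbch, sub_self]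

end Associative

/-! ### Removing the grading hypothesis by a polynomial parameter -/

section PolynomialParameter

open Polynomial

attribute [local instance] LieRing.ofAssociativeRing

variable {A : Type*} [Ring A] [Algebra ℝ A]

/-- The polynomials with coefficients in `Q`. -/
def coeffsIn (Q : Submodule ℝ A) : Submodule ℝ A[X] where
  carrier := {p | ∀ n, p.coeff n ∈ Q}
  zero_mem' n := by simp
  add_mem' hp hq n := by rw [coeff_add]; exact add_mem (hp n) (hq n)
  smul_mem' r p hp n := by rw [coeff_smul]; exact Q.smul_mem r (hp n)

theorem coeffsIn_mono {P Q : Submodule ℝ A} (h : P ≤ Q) : coeffsIn P ≤ coeffsIn Q :=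
  fun _ hp n => h (hp n)

theorem coeffsIn_mul_le (P Q : Submodule ℝ A) : coeffsIn P * coeffsIn Q ≤ coeffsIn (P * Q) :=
  Submodule.mul_le.mpr fun p hp q hq n => by
    rw [coeff_mul]
    exact sum_mem fun i _ => Submodule.mul_mem_mul (hp _) (hq _)

theorem coeffsIn_pow_le (Q : Submodule ℝ A) (n : ℕ) :
    coeffsIn Q ^ (n + 1) ≤ coeffsIn (Q ^ (n + 1)) := by
  induction n with
  | zero => simp
  | succ n ih =>
    rw [pow_succ, pow_succ Q]
    exact (mul_le_mul' ih le_rfl).trans (coeffsIn_mul_le _ _)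

theorem coeffsIn_pow_eq_bot {Q : Submodule ℝ A} {N : ℕ} (hN : Q ^ (N + 1) = ⊥) :
    coeffsIn Q ^ (N + 1) = ⊥ := by
  refine eq_bot_iff.mpr fun p hp => ?_
  have h := coeffsIn_pow_le Q N hp
  rw [hN] at h
  rw [Submodule.mem_bot]
  ext n
  simpa using h n

theorem monomial_mem_coeffsIn {Q : Submodule ℝ A} {a : A} (ha : a ∈ Q) (n : ℕ) :
    monomial n a ∈ coeffsIn Q := fun m => by
  rw [coeff_monomial]
  split_ifs
  exacts [ha, zero_mem _]

/-- The operator `X d/dX` on polynomials with coefficients in `A`. -/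
noncomputable def eulerEnd (A : Type*) [Ring A] [Algebra ℝ A] : Module.End ℝ A[X] where
  toFun p := derivative p * X
  map_add' p q := by rw [derivative_add, add_mul]
  map_smul' r p := by rw [derivative_smul, smul_mul_assoc, RingHom.id_apply]

theorem lie_eulerEnd_lmul_monomial (a : A) :
    ⁅eulerEnd A, Algebra.lmul ℝ A[X] (monomial 1 a)⁆ = Algebra.lmul ℝ A[X] (monomial 1 a) := by
  refine LinearMap.ext fun p => ?_
  change derivative (monomial 1 a * p) * X - monomial 1 a * (derivative p * X) = monomial 1 a * p
  rw [derivative_mul, add_mul, mul_assoc _ (derivative p), add_sub_cancel_right, derivative_monomial,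
    ← C_mul_X_eq_monomial, mul_assoc, mul_assoc, X_mul]
  simp

/-- The Baker–Campbell–Hausdorff formula in a nilpotent associative algebra. -/
theorem expN_bch {Q : Submodule ℝ A} (hQ : Q * Q ≤ Q) {N : ℕ} (hN : Q ^ (N + 1) = ⊥) {x y : A}
    (hx : x ∈ Q) (hy : y ∈ Q) :
    expN (2 * N + 2) (bch x y) = expN (2 * N + 2) x * expN (2 * N + 2) y := by
  -- The grading element `X d/dX` is an operator on `A[X]`, so the graded formula is applied to left
  -- multiplications inside `End A[X]`.
  let Λ := Algebra.lmul ℝ A[X]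
  have hxQ := monomial_mem_coeffsIn hx 1
  have hyQ := monomial_mem_coeffsIn hy 1
  have hterm : ∀ d, N + 1 ≤ d → bchTerm d (monomial 1 x) (monomial 1 y) = 0 := fun d hd =>
    bchTerm_eq_zero_of_pow (coeffsIn_pow_eq_bot hN) hxQ hyQ hd
  have h := expN_bch_of_grading (Q := (coeffsIn Q).map Λ.toLinearMap) (N := N) (δ := eulerEnd A)
    (by
      rw [← Submodule.map_mul]
      exact Submodule.map_mono ((coeffsIn_mul_le Q Q).trans (coeffsIn_mono hQ)))
    (by rw [← Submodule.map_pow, coeffsIn_pow_eq_bot hN, Submodule.map_bot])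
    (Submodule.mem_map_of_mem hxQ) (Submodule.mem_map_of_mem hyQ)
    (lie_eulerEnd_lmul_monomial x) (lie_eulerEnd_lmul_monomial y)
  have h1 := map_bch Λ.toLieHom hterm
  change expN _ (bch (Λ.toLieHom (monomial 1 x)) (Λ.toLieHom (monomial 1 y)))
    = expN _ (Λ (monomial 1 x)) * expN _ (Λ (monomial 1 y)) at h
  rw [← h1] at h
  change expN _ (Λ (bch (monomial 1 x) (monomial 1 y))) = _ at h
  rw [← map_expN, ← map_expN, ← map_expN, ← map_mul] at h
  -- A left multiplication is recovered from its value at `1`.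
  have h2 := LinearMap.congr_fun h 1
  simp only [Λ, Algebra.coe_lmul_eq_mul, LinearMap.mul_apply_apply, mul_one] at h2
  -- Evaluation at `1` is multiplicative although `A` need not be commutative, because `1` is
  -- central.
  let ev : A[X] →ₐ[ℝ] A :=
    { eval₂RingHom' (RingHom.id A) 1 fun a => Commute.one_right a with
      commutes' := fun r => by simp [Polynomial.algebraMap_apply] }
  have hev : ∀ a, ev (monomial 1 a) = a := fun a => by
    change eval₂ _ _ _ = _
    simp
  have h3 := congrArg ev h2
  have h4 := map_bch ev.toLieHom hterm
  change ev (bch _ _) = bch (ev _) (ev _) at h4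
  rwa [map_expN, map_mul, map_expN, map_expN, h4, hev, hev] at h3

/-- The Baker–Campbell–Hausdorff product is associative in nilpotent associative algebras. -/
theorem bch_assoc_of_mul {Q : Submodule ℝ A} (hQ : Q * Q ≤ Q) {N : ℕ} (hN : Q ^ (N + 1) = ⊥)
    {x y z : A} (hx : x ∈ Q) (hy : y ∈ Q) (hz : z ∈ Q) :
    bch (bch x y) z = bch x (bch y z) := by
  have nil : ∀ a ∈ Q, a ^ (2 * N + 2) = 0 := fun a ha =>
    pow_eq_zero_of_le (by omega) (pow_eq_zero_of_mem hN ha)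
  have hxy := bch_mem_of_mul hQ hN hx hy
  have hyz := bch_mem_of_mul hQ hN hy hz
  refine expN_injOn (nil _ (bch_mem_of_mul hQ hN hxy hz)) (nil _ (bch_mem_of_mul hQ hN hx hyz)) ?_
  rw [expN_bch hQ hN hxy hz, expN_bch hQ hN hx hyz, expN_bch hQ hN hx hy, expN_bch hQ hN hy hz,
    mul_assoc]

end PolynomialParameter

/-! ### Associativity of the Baker–Campbell–Hausdorff product -/

section Nilpotent

/-- If all words of length `N` in the elements `ρ g` vanish, these elements lie in a submodule that
is closed under multiplication and nilpotent. -/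
theorem exists_nilpotent_submodule {G A : Type*} [Ring A] [Algebra ℝ A] (ρ : G → A) {N : ℕ}
    (h : ∀ l : List G, l.length = N → (l.map ρ).prod = 0) :
    ∃ Q : Submodule ℝ A, Q * Q ≤ Q ∧ Q ^ N = ⊥ ∧ ∀ g, ρ g ∈ Q := by
  -- `F m` consists of the elements annihilated from the left by all words of length `m`. It
  -- increases with `m`, `F 0` is zero, and `F N` contains `1`.
  let F : ℕ → Set A := fun m => {v | ∀ l : List G, l.length = m → (l.map ρ).prod * v = 0}
  have hF : ∀ m v, v ∈ F m → v ∈ F (m + 1) := by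
    intro m v hv l hl
    obtain ⟨a, t, rfl⟩ := List.exists_cons_of_length_eq_add_one hl
    rw [List.map_cons, List.prod_cons, mul_assoc, hv t (by simpa using hl), mul_zero]
  -- The elements that lower this filtration by one step. Such elements are closed under products,
  -- and a product of `N` of them sends `1 ∈ F N` into `F 0 = 0`.
  let Q : Submodule ℝ A :=
    { carrier := {T | ∀ m, ∀ v ∈ F (m + 1), T * v ∈ F m}
      zero_mem' := fun m v _ l _ => by rw [zero_mul, mul_zero]
      add_mem' := fun {S T} hS hT m v hv l hl => by
        rw [add_mul, mul_add, hS m v hv l hl, hT m v hv l hl, add_zero]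
      smul_mem' := fun r T hT m v hv l hl => by
        rw [smul_mul_assoc, mul_smul_comm, hT m v hv l hl, smul_zero] }
  refine ⟨Q, Submodule.mul_le.mpr fun S hS T hT m v hv => ?_, ?_, fun g m v hv l hl => ?_⟩
  · rw [mul_assoc]
    exact hS m _ (hF m _ (hT m v hv))
  · have key : ∀ n, ∀ T ∈ Q ^ n, ∀ m, ∀ v ∈ F (m + n), T * v ∈ F m := by
      intro n
      induction n with
      | zero =>
        intro T hT m v hv
        rw [pow_zero, Submodule.mem_one] at hT
        obtain ⟨r, rfl⟩ := hT
        intro l hl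
        rw [← Algebra.smul_def, mul_smul_comm, hv l hl, smul_zero]
      | succ n ih =>
        intro T hT m v hv
        rw [pow_succ'] at hT
        refine Submodule.mul_induction_on hT (fun S hS U hU => ?_) fun S U hS hU l hl => ?_
        · rw [mul_assoc]
          exact hS m _ (ih U hU (m + 1) v (by rwa [add_assoc, add_comm 1 n]))
        · rw [add_mul, mul_add, hS l hl, hU l hl, add_zero]
    refine eq_bot_iff.mpr fun T hT => ?_
    have h1 := key N T hT 0 1 (fun l hl => by rw [h l (by simpa using hl), zero_mul]) [] rfl
    simpa using h1
  · have := hv (l ++ [g]) (by simp [hl])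
    rwa [List.map_append, List.prod_append, List.map_singleton, List.prod_singleton,
      mul_assoc] at this

/-- All `k`-fold nested brackets vanish. -/
def NestedVanish (L : Type*) [LieRing L] (k : ℕ) : Prop :=
  ∀ l : List L, l.length = k → ∀ y : L, l.foldr (fun a b => ⁅a, b⁆) y = 0

/-- The vanishing of nested products passes to tensor products. -/
theorem foldr_map₂_eq_zero {A V : Type*} [AddCommGroup A] [Module ℝ A] [AddCommGroup V]
    [Module ℝ V] (m : A →ₗ[ℝ] A →ₗ[ℝ] A) (b : V →ₗ[ℝ] V →ₗ[ℝ] V) {k : ℕ}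
    (h : ∀ l : List V, l.length = k → ∀ y, l.foldr (fun v w => b v w) y = 0)
    (l : List (A ⊗[ℝ] V)) (hl : l.length = k) (y : A ⊗[ℝ] V) :
    l.foldr (fun v w => TensorProduct.map₂ m b v w) y = 0 := by
  -- By bilinearity the `A`-factors collect into one coefficient while the `V`-factors form a nested
  -- product. Neither parity nor signs enter.
  have key : ∀ (n : ℕ) (l : List (A ⊗[ℝ] V)), l.length = n → ∀ y,
      l.foldr (fun v w => TensorProduct.map₂ m b v w) y ∈ Submodule.span ℝ
        {t | ∃ (a : A) (l' : List V) (v : V), l'.length = n ∧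
          t = a ⊗ₜ[ℝ] l'.foldr (fun v w => b v w) v} := by
    intro n l hl
    induction l generalizing n with
    | nil =>
      subst hl
      intro y
      induction y using TensorProduct.induction_on with
      | zero => exact zero_mem _
      | tmul a v => exact Submodule.subset_span ⟨a, [], v, rfl, rfl⟩
      | add y z hy hz => exact add_mem hy hz
    | cons x l ih =>
      subst hl
      intro y
      rw [List.foldr_cons]
      have hmem := ih l.length rfl y
      generalize l.foldr (fun v w => TensorProduct.map₂ m b v w) y = s at hmem
      induction hmem using Submodule.span_induction with
      | zero => rw [map_zero]; exact zero_mem _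
      | add s t _ _ hs ht => rw [map_add]; exact add_mem hs ht
      | smul r s _ hs => rw [map_smul]; exact Submodule.smul_mem _ r hs
      | mem s hs =>
        obtain ⟨a, l', v, hl', rfl⟩ := hs
        induction x using TensorProduct.induction_on with
        | zero => rw [map_zero]; exact zero_mem _
        | add s t hs ht => rw [map_add]; exact add_mem hs ht
        | tmul a' v' =>
          exact Submodule.subset_span ⟨m a' a, v' :: l', v, by simp [hl'], rfl⟩
  have h0 := key k l hl y
  rw [← Submodule.mem_bot ℝ]
  refine Submodule.span_le.mpr ?_ h0
  rintro _ ⟨a, l', v, hl', rfl⟩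
  rw [h l' hl' v, TensorProduct.tmul_zero]
  exact zero_mem _

variable {L : Type*} [LieRing L]

theorem NestedVanish.nestedLie_eq_zero {k : ℕ} (h : NestedVanish L k) (w : List L)
    (hw : k < w.length) : nestedLie w = 0 := by
  induction w with
  | nil => rfl
  | cons a w ih =>
    rcases Nat.lt_or_ge k w.length with h' | h'
    · obtain _ | ⟨b, w⟩ := w
      · simp at h'
      · rw [nestedLie, ih h', lie_zero]
    -- Here the word has exactly `k + 1` letters: `k` brackets applied to the last letter.
    · rw [List.length_cons] at hw
      have hne : a :: w ≠ [] := by simp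
      rw [← List.dropLast_append_getLast hne, nestedLie_append _ (by simp)]
      refine h _ ?_ _
      rw [List.length_dropLast, List.length_cons]
      omega

variable [LieAlgebra ℝ L]

theorem NestedVanish.bchTerm_eq_zero {k : ℕ} (h : NestedVanish L k) (x y : L) {d : ℕ}
    (hd : k + 1 ≤ d) : bchTerm d x y = 0 :=
  SuperGeom.bchTerm_eq_zero fun w _ hw => h.nestedLie_eq_zero w (by omega)

theorem NestedVanish.isNilpotent {k : ℕ} (h : NestedVanish L k) : LieRing.IsNilpotent L := by
  rw [LieRing.IsNilpotent, LieModule.isNilpotent_iff ℝ]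
  refine ⟨k, eq_bot_iff.mpr fun y hy => ?_⟩
  -- Descending generalisation: an element of the `n`-th term is killed by the `k - n` brackets
  -- still to come. A generator `⁅a, b⁆` moves `a` to the end of the list and leaves `b` one term
  -- earlier.
  have key : ∀ n, ∀ y ∈ LieModule.lowerCentralSeries ℝ L L n, ∀ l : List L,
      l.length + n = k → l.foldr (fun a b => ⁅a, b⁆) y = 0 := by
    have hadd : ∀ (l : List L) (y z : L), l.foldr (fun a b => ⁅a, b⁆) (y + z)
        = l.foldr (fun a b => ⁅a, b⁆) y + l.foldr (fun a b => ⁅a, b⁆) z := by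
      intro l y z
      induction l with
      | nil => rfl
      | cons a l ih => rw [List.foldr_cons, ih, lie_add]; rfl
    have hsmul : ∀ (l : List L) (r : ℝ) (y : L), l.foldr (fun a b => ⁅a, b⁆) (r • y)
        = r • l.foldr (fun a b => ⁅a, b⁆) y := by
      intro l r y
      induction l with
      | nil => rfl
      | cons a l ih => rw [List.foldr_cons, ih, lie_smul]; rfl
    intro n
    induction n with
    | zero => intro y _ l hl; exact h l hl y
    | succ n ih =>
      intro y hy
      rw [LieModule.lowerCentralSeries_succ, ← LieSubmodule.mem_toSubmodule,
        LieSubmodule.lieIdeal_oper_eq_linear_span'] at hy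
      induction hy using Submodule.span_induction with
      | mem z hz =>
        obtain ⟨a, _, b, hb, rfl⟩ := hz
        intro l hl
        have := ih b hb (l ++ [a]) (by simp; omega)
        rwa [List.foldr_append] at this
      | zero => intro l _; simpa using hsmul l 0 0
      | add y z _ _ hy hz => intro l hl; rw [hadd, hy l hl, hz l hl, add_zero]
      | smul r y _ hy => intro l hl; rw [hsmul, hy l hl, smul_zero]
  exact (LieSubmodule.mem_bot y).mpr (key k y hy [] (by simp))

theorem bchTerm_zero_degree (x y : L) : bchTerm 0 x y = 0 := rfl

theorem bchTerm_one (x y : L) : bchTerm 1 x y = x + y := by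
  have h : ((Fintype.piFinset fun _ : Fin 1 => Finset.range 2 ×ˢ Finset.range 2).filter
      (fun p => (∀ i, 0 < (p i).1 + (p i).2) ∧ ∑ i, ((p i).1 + (p i).2) = 1))
      = {fun _ => (1, 0), fun _ => (0, 1)} := by
    decide
  have hne : (fun _ : Fin 1 => ((1, 0) : ℕ × ℕ)) ≠ fun _ => (0, 1) := by decide
  rw [bchTerm, Finset.Icc_self, Finset.sum_singleton, h, Finset.sum_pair hne]
  simp [nestedLie]

/-- Every word of length at least two contains an innermost bracket of two letters. No nilpotency is
needed, so this covers both the unit and the inverse laws. -/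
theorem bchTerm_eq_zero_of_commute {x y : L} (h : ⁅x, y⁆ = 0) {d : ℕ} (hd : 2 ≤ d) :
    bchTerm d x y = 0 := by
  refine bchTerm_eq_zero fun w hw hl => ?_
  subst hl
  have h' : ⁅y, x⁆ = 0 := by rw [← lie_skew, h, neg_zero]
  have key : ∀ a b : L, (a = x ∨ a = y) → (b = x ∨ b = y) → ⁅a, b⁆ = 0 := by
    rintro a b (rfl | rfl) (rfl | rfl) <;> simp [h, h']
  induction w with
  | nil => simp at hd
  | cons a w ih =>
    obtain _ | ⟨b, _ | ⟨c, w⟩⟩ := w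
    · simp at hd
    · exact key a b (hw a (by simp)) (hw b (by simp))
    · rw [nestedLie, ih (fun z hz => hw z (by simp [hz])) (by simp), lie_zero]

theorem bch_of_commute {x y : L} (h : ⁅x, y⁆ = 0) : bch x y = x + y := by
  rw [bch_eq_sum (N := 2) fun d hd => bchTerm_eq_zero_of_commute h hd, Finset.sum_range_succ,
    Finset.sum_range_one, bchTerm_one, bchTerm_zero_degree, zero_add]

end Nilpotent

/-! ### Associativity in nilpotent Lie algebras, through a derivation and a polynomial parameter -/

section LieAssoc

attribute [local instance] LieRing.ofAssociativeRing

/-- The adjoint representation of the semidirect product `G ⋊ ℝ D`, restricted to `G`. -/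
noncomputable def derivationRep {G : Type*} [LieRing G] [LieAlgebra ℝ G] (D : G →ₗ[ℝ] G)
    (hD : ∀ p q, D ⁅p, q⁆ = ⁅D p, q⁆ + ⁅p, D q⁆) : G →ₗ⁅ℝ⁆ Module.End ℝ (G × ℝ) where
  toFun p :=
    { toFun := fun v => (⁅p, v.1⁆ + v.2 • D p, 0)
      map_add' := fun v w => by
        simp only [Prod.fst_add, Prod.snd_add, lie_add, add_smul, Prod.mk_add_mk, add_zero]
        congr 1
        abel
      map_smul' := fun r v => by
        simp only [Prod.smul_fst, Prod.smul_snd, lie_smul, smul_eq_mul, mul_smul, RingHom.id_apply,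
          Prod.smul_mk, smul_add, mul_zero] }
  map_add' p q := LinearMap.ext fun v => by
    simp only [LinearMap.coe_mk, AddHom.coe_mk, LinearMap.add_apply, add_lie, map_add, smul_add,
      Prod.mk_add_mk, add_zero]
    congr 1
    abel
  map_smul' r p := LinearMap.ext fun v => by
    simp only [LinearMap.coe_mk, AddHom.coe_mk, LinearMap.smul_apply, smul_lie, map_smul,
      smul_comm v.2 r, Prod.smul_mk, smul_add, smul_zero, RingHom.id_apply]
  map_lie' {p q} := LinearMap.ext fun v => by
    simp only [LinearMap.coe_mk, AddHom.coe_mk, LieRing.of_associative_ring_bracket,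
      LinearMap.sub_apply, Module.End.mul_apply, lie_add, lie_smul, zero_smul, add_zero,
      Prod.mk_sub_mk, sub_zero, hD, smul_add]
    congr 1
    rw [lie_lie, ← lie_skew q (D p), smul_neg]
    abel

theorem derivationRep_apply {G : Type*} [LieRing G] [LieAlgebra ℝ G] (D : G →ₗ[ℝ] G)
    (hD : ∀ p q, D ⁅p, q⁆ = ⁅D p, q⁆ + ⁅p, D q⁆) (p : G) (v : G × ℝ) :
    derivationRep D hD p v = (⁅p, v.1⁆ + v.2 • D p, 0) := rfl

/-- The operator applied first lands in `G × 0`, where the remaining `k` act as nested brackets;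
hence one letter more than in `G`. -/
theorem derivationRep_prod_eq_zero {G : Type*} [LieRing G] [LieAlgebra ℝ G] (D : G →ₗ[ℝ] G)
    (hD : ∀ p q, D ⁅p, q⁆ = ⁅D p, q⁆ + ⁅p, D q⁆) {k : ℕ} (h : NestedVanish G k) (l : List G)
    (hl : l.length = k + 1) : (l.map (derivationRep D hD)).prod = 0 := by
  have aux : ∀ (l : List G) (q : G), (l.map (derivationRep D hD)).prod (q, 0)
      = (l.foldr (fun a b => ⁅a, b⁆) q, 0) := by
    intro l q
    induction l with
    | nil => rfl
    | cons a l ih =>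
      rw [List.map_cons, List.prod_cons, Module.End.mul_apply, ih, derivationRep_apply]
      simp
  have hne : l ≠ [] := by rintro rfl; simp at hl
  rw [← List.dropLast_append_getLast hne, List.map_append, List.prod_append]
  refine LinearMap.ext fun v => ?_
  rw [Module.End.mul_apply, List.map_singleton, List.prod_singleton, derivationRep_apply, aux,
    h _ (by simp [hl])]
  rfl

/-- In a nilpotent Lie algebra with a derivation `D`, the Baker–Campbell–Hausdorff product is
associative up to the kernel of `D`. -/
theorem derivation_bch_assoc {G : Type*} [LieRing G] [LieAlgebra ℝ G] (D : G →ₗ[ℝ] G)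
    (hD : ∀ p q, D ⁅p, q⁆ = ⁅D p, q⁆ + ⁅p, D q⁆) {k : ℕ} (h : NestedVanish G k) (p q r : G) :
    D (bch (bch p q) r) = D (bch p (bch q r)) := by
  obtain ⟨Q, hQ, hN, hρ⟩ := exists_nilpotent_submodule (derivationRep D hD)
    (derivationRep_prod_eq_zero D hD h)
  have hm : ∀ a b : G, derivationRep D hD (bch a b)
      = bch (derivationRep D hD a) (derivationRep D hD b) :=
    fun a b => map_bch _ fun d hd => h.bchTerm_eq_zero a b hd
  have h1 : derivationRep D hD (bch (bch p q) r) = derivationRep D hD (bch p (bch q r)) := by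
    rw [hm, hm, hm, hm, bch_assoc_of_mul hQ hN (hρ p) (hρ q) (hρ r)]
  -- The vector `(0, 1)` stands for the derivation itself: `p` sends it to `(D p, 0)`.
  have h2 := congrArg Prod.fst (LinearMap.congr_fun h1 (0, 1))
  simpa [derivationRep_apply] using h2

open Polynomial

variable {L : Type*} [LieRing L] [LieAlgebra ℝ L]

/-- Puts the bracket of the scalar extension into the form required by `foldr_map₂_eq_zero`. -/
theorem lie_eq_map₂ (v w : ℝ[X] ⊗[ℝ] L) : ⁅v, w⁆
    = TensorProduct.map₂ (LinearMap.mul ℝ ℝ[X]) (LieModule.toEnd ℝ L L).toLinearMap v w := by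
  induction v using TensorProduct.induction_on with
  | zero => rw [map_zero]; exact zero_lie w
  | add a b ha hb => rw [map_add, LinearMap.add_apply, ← ha, ← hb]; exact add_lie a b w
  | tmul a x =>
    induction w using TensorProduct.induction_on with
    | zero => rw [map_zero]; exact lie_zero (L := ℝ[X] ⊗[ℝ] L) (M := ℝ[X] ⊗[ℝ] L) _
    | add c d hc hd => rw [map_add, ← hc, ← hd]; exact lie_add (L := ℝ[X] ⊗[ℝ] L) (M := ℝ[X] ⊗[ℝ] L) _ c d
    | tmul b y => rfl

theorem nestedVanish_polynomial {k : ℕ} (h : NestedVanish L k) :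
    NestedVanish (ℝ[X] ⊗[ℝ] L) k := fun l hl y => by
  have e := foldr_map₂_eq_zero (LinearMap.mul ℝ ℝ[X]) (LieModule.toEnd ℝ L L).toLinearMap h l hl y
  simp only [← lie_eq_map₂] at e
  exact e

/-- Evaluation at `t` of polynomials with coefficients in a Lie algebra. -/
noncomputable def evalLie (L : Type*) [LieRing L] [LieAlgebra ℝ L] (t : ℝ) :
    ℝ[X] ⊗[ℝ] L →ₗ⁅ℝ⁆ L :=
  { TensorProduct.lift (LinearMap.lsmul ℝ L ∘ₗ (aeval (R := ℝ) t).toLinearMap) with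
    map_lie' := fun {p q} => by
      simp only [AddHom.toFun_eq_coe, LinearMap.coe_toAddHom]
      induction p using TensorProduct.induction_on with
      | zero => simp only [zero_lie, map_zero]
      | add a b ha hb => simp only [add_lie, map_add, ha, hb]
      | tmul a x =>
        induction q using TensorProduct.induction_on with
        | zero => simp only [lie_zero, map_zero]
        | add a b ha hb => simp only [lie_add, map_add, ha, hb]
        | tmul b y =>
          rw [LieAlgebra.ExtendScalars.bracket_tmul]
          simp only [TensorProduct.lift.tmul, LinearMap.comp_apply, AlgHom.toLinearMap_apply,
            LinearMap.lsmul_apply, map_mul, smul_lie, lie_smul, mul_smul]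
          exact smul_comm _ _ _ }

theorem evalLie_tmul (t : ℝ) (p : ℝ[X]) (x : L) : evalLie L t (p ⊗ₜ x) = p.eval t • x := by
  change aeval t p • x = _
  rw [coe_aeval_eq_eval]

/-- The derivation `X d/dX` on polynomials with coefficients in a Lie algebra. -/
noncomputable def eulerLie (L : Type*) [LieRing L] [LieAlgebra ℝ L] :
    ℝ[X] ⊗[ℝ] L →ₗ[ℝ] ℝ[X] ⊗[ℝ] L :=
  LinearMap.rTensor L (LinearMap.mulLeft ℝ X ∘ₗ derivative)

theorem eulerLie_tmul (p : ℝ[X]) (x : L) :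
    eulerLie L (p ⊗ₜ x) = (X * derivative p) ⊗ₜ[ℝ] x := rfl

theorem eulerLie_lie (p q : ℝ[X] ⊗[ℝ] L) :
    eulerLie L ⁅p, q⁆ = ⁅eulerLie L p, q⁆ + ⁅p, eulerLie L q⁆ := by
  induction p using TensorProduct.induction_on with
  | zero => simp only [lie_eq_map₂, LinearMap.zero_apply, map_zero, add_zero]
  | add a b ha hb =>
    simp only [lie_eq_map₂, LinearMap.add_apply, map_add] at ha hb ⊢
    rw [ha, hb, add_add_add_comm]
  | tmul a x =>
    induction q using TensorProduct.induction_on with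
    | zero => simp only [lie_eq_map₂, map_zero, add_zero]
    | add a b ha hb =>
      simp only [lie_eq_map₂, map_add] at ha hb ⊢
      rw [ha, hb, add_add_add_comm]
    | tmul b y =>
      simp only [LieAlgebra.ExtendScalars.bracket_tmul, eulerLie_tmul, derivative_mul,
        ← TensorProduct.add_tmul]
      congr 1
      ring

/-- A polynomial with coefficients in `L` without constant term is determined by its image under
`X d/dX`. -/
theorem eq_of_eulerLie_eq {p q : ℝ[X] ⊗[ℝ] L} (h : eulerLie L p = eulerLie L q)
    (hp : evalLie L 0 p = 0) (hq : evalLie L 0 q = 0) : p = q := by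
  -- `J` divides the coefficient of `X ^ n` by `n`, and kills constants because `0⁻¹ = 0`. It
  -- inverts `X d/dX` up to the value at `0`.
  let J : ℝ[X] →ₗ[ℝ] ℝ[X] := Polynomial.lsum fun n => (n : ℝ)⁻¹ • Polynomial.monomial n
  have key : ∀ p : ℝ[X] ⊗[ℝ] L,
      LinearMap.rTensor L J (eulerLie L p) + (1 : ℝ[X]) ⊗ₜ[ℝ] evalLie L 0 p = p := by
    intro p
    induction p using TensorProduct.induction_on with
    | zero => simp only [map_zero, TensorProduct.tmul_zero, add_zero]
    | add a b ha hb =>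
      rw [map_add, map_add, map_add, TensorProduct.tmul_add, add_add_add_comm, ha, hb]
    | tmul a x =>
      rw [eulerLie_tmul, LinearMap.rTensor_tmul, evalLie_tmul, ← TensorProduct.smul_tmul,
        ← TensorProduct.add_tmul]
      congr 1
      induction a using Polynomial.induction_on' with
      | add p q hp hq =>
        rw [derivative_add, mul_add, map_add, eval_add, add_smul, add_add_add_comm, hp, hq]
      | monomial n r =>
        obtain _ | n := n
        · simp [smul_eq_C_mul]
        · have hn : (n : ℝ) + 1 ≠ 0 := by positivity
          rw [derivative_monomial, X_mul_monomial]
          simp [J, smul_monomial]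
          field_simp
  rw [← key p, ← key q, h, hp, hq]

theorem bch_zero (x : L) : bch x 0 = x := by
  rw [bch_of_commute (lie_zero x), add_zero]

theorem zero_bch (x : L) : bch 0 x = x := by
  rw [bch_of_commute (zero_lie x), zero_add]

/-- The Baker–Campbell–Hausdorff product on a nilpotent Lie algebra is associative. -/
theorem NestedVanish.bch_assoc {k : ℕ} (h : NestedVanish L k) (x y z : L) :
    bch (bch x y) z = bch x (bch y z) := by
  have hG := nestedVanish_polynomial h
  have hm : ∀ (t : ℝ) (p q : ℝ[X] ⊗[ℝ] L),
      evalLie L t (bch p q) = bch (evalLie L t p) (evalLie L t q) :=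
    fun t p q => map_bch _ fun d hd => hG.bchTerm_eq_zero p q hd
  have h0 : ∀ v : L, evalLie L 0 ((X : ℝ[X]) ⊗ₜ v) = 0 := fun v => by simp [evalLie_tmul]
  have h1 : ∀ v : L, evalLie L 1 ((X : ℝ[X]) ⊗ₜ v) = v := fun v => by simp [evalLie_tmul]
  -- Multiplying the arguments by `X` makes both triple products vanish at `X = 0`, which removes
  -- the ambiguity by the kernel of `X d/dX`.
  have e := congrArg (evalLie L 1) <| eq_of_eulerLie_eq
    (derivation_bch_assoc (eulerLie L) eulerLie_lie hG (X ⊗ₜ x) (X ⊗ₜ y) (X ⊗ₜ z))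
    (by simp only [hm, h0, bch_zero]) (by simp only [hm, h0, bch_zero])
  simpa only [hm, h1] using e

end LieAssoc

/-! ### The supergroup of a nilpotent Lie superalgebra -/

section Supergroup

variable {n : ℕ} {V W : SuperSpace.{u}} {g : LieSuperalgebra.{u}}

theorem val_foldr_lie (l : List (Pts g.toSuperSpace n)) (y : Pts g.toSuperSpace n) :
    (l.foldr (fun a b => ⁅a, b⁆) y).val
      = (l.map Pts.val).foldr (fun a b => g.tensorBracket n a b) y.val := by
  induction l with
  | nil => rfl
  | cons a l ih => rw [List.foldr_cons, val_lie, ih]; rfl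

/-- The same `k` works for every Grassmann algebra; this is the source of the uniform bound on the
series. -/
theorem LieSuperalgebra.IsStepNilpotent.nestedVanish {k : ℕ} (h : g.IsStepNilpotent k) (n : ℕ) :
    NestedVanish (Pts g.toSuperSpace n) k := fun l hl y => by
  refine Pts.ext ?_
  rw [val_foldr_lie, map_zero]
  refine foldr_map₂_eq_zero _ g.bracket (k := k) (fun l hl y => ?_) _ (by simpa using hl) _
  subst hl
  rw [← List.ofFn_get l]
  simpa using h l.get y

/-- The map `g_A → g_B` induced by a homomorphism `A → B` is a homomorphism of Lie algebras. -/
noncomputable def Pts.mapLie (g : LieSuperalgebra.{u}) {m n : ℕ} (f : GrHom m n) :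
    Pts g.toSuperSpace m →ₗ⁅ℝ⁆ Pts g.toSuperSpace n :=
  { Pts.map g.toSuperSpace f with
    map_lie' := fun {x y} => by
      change Pts.map g.toSuperSpace f ⁅x, y⁆
        = ⁅Pts.map g.toSuperSpace f x, Pts.map g.toSuperSpace f y⁆
      induction x using Pts.induction with
      | zero => simp only [zero_lie, map_zero]
      | add a b ha hb => simp only [add_lie, map_add, ha, hb]
      | tmul i a ha X hX =>
        induction y using Pts.induction with
        | zero => simp only [lie_zero, map_zero]
        | add a b ha hb => simp only [lie_add, map_add, ha, hb]
        | tmul j b hb Y hY =>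
          refine Pts.ext ?_
          change f.toAlgHom (b * a) ⊗ₜ[ℝ] g.bracket X Y
            = (f.toAlgHom b * f.toAlgHom a) ⊗ₜ[ℝ] g.bracket X Y
          rw [map_mul] }

theorem EvenSmooth.const_smul {φ : Pts V n → Pts W n} (r : ℝ) (hφ : EvenSmooth φ) :
    EvenSmooth (fun x => r • φ x) := by
  have h := (EvenSmooth.linear (algebraMap ℝ (EvenPart n) r • LinearMap.id)).comp hφ
  simpa [algebraMap_smul] using h

theorem EvenSmooth.zero : EvenSmooth (fun _ : Pts V n => (0 : Pts W n)) := EvenSmooth.linear 0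

theorem EvenSmooth.sum {ι : Type*} (s : Finset ι) {φ : ι → Pts V n → Pts W n}
    (h : ∀ i ∈ s, EvenSmooth (φ i)) : EvenSmooth (fun x => ∑ i ∈ s, φ i x) := by
  classical
  induction s using Finset.induction_on with
  | empty => simpa using EvenSmooth.zero
  | insert i s hi ih =>
    simp only [Finset.sum_insert hi]
    exact (h i (by simp)).add (ih fun j hj => h j (by simp [hj]))

/-- By the Leibniz rule the derivative is a sum of two brackets, and each is `A₀`-linear in the
direction because the bracket is `A₀`-bilinear. -/
theorem EvenSmooth.lie {φ ψ : Pts V n → Pts g.toSuperSpace n} (hφ : EvenSmooth φ)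
    (hψ : EvenSmooth ψ) : EvenSmooth (fun x => ⁅φ x, ψ x⁆) := by
  let B : Pts g.toSuperSpace n →L[ℝ] Pts g.toSuperSpace n →L[ℝ] Pts g.toSuperSpace n :=
    LinearMap.toContinuousLinearMap (LinearMap.toContinuousLinearMap.toLinearMap ∘ₗ
      LinearMap.mk₂ ℝ (fun x y => ⁅x, y⁆) add_lie smul_lie lie_add fun r x y => lie_smul r x y)
  refine ⟨B.isBoundedBilinearMap.contDiff.comp (hφ.1.prodMk hψ.1), fun x a v => ?_⟩
  have h := B.fderiv_of_bilinear ((hφ.1.differentiable (by simp)) x)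
    ((hψ.1.differentiable (by simp)) x)
  have h' : ∀ w, fderiv ℝ (fun x => ⁅φ x, ψ x⁆) x w
      = ⁅φ x, fderiv ℝ ψ x w⁆ + ⁅fderiv ℝ φ x w, ψ x⁆ := fun w => congrArg (fun f => f w) h
  rw [h', h', hφ.2, hψ.2, lie_smul, smul_lie, smul_add]

theorem EvenSmooth.nestedLie (l : List (Pts V n → Pts g.toSuperSpace n))
    (h : ∀ φ ∈ l, EvenSmooth φ) : EvenSmooth (fun x => nestedLie (l.map fun φ => φ x)) := by
  induction l with
  | nil => exact EvenSmooth.zero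
  | cons φ l ih =>
    obtain _ | ⟨ψ, l⟩ := l
    · exact h φ (by simp)
    · exact (h φ (by simp)).lie (ih fun χ hχ => h χ (by simp [hχ]))

theorem EvenSmooth.bchTerm (d : ℕ) {φ ψ : Pts V n → Pts g.toSuperSpace n} (hφ : EvenSmooth φ)
    (hψ : EvenSmooth ψ) : EvenSmooth (fun x => bchTerm d (φ x) (ψ x)) := by
  refine EvenSmooth.sum _ fun k _ => EvenSmooth.const_smul _ <| EvenSmooth.sum _ fun p _ =>
    EvenSmooth.const_smul _ ?_
  -- The word is formed with the functions `φ`, `ψ` as letters and then evaluated letter by letter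
  -- at the point.
  have h := EvenSmooth.nestedLie (blockWord φ ψ p) fun χ hχ => by
    rcases mem_blockWord hχ with rfl | rfl <;> assumption
  simpa only [blockWord, List.map_flatten, List.map_ofFn, Function.comp_def, List.map_append,
    List.map_replicate] using h

/-- The multiplication given by the Baker–Campbell–Hausdorff product. -/
noncomputable def bchMul {k : ℕ} (h : g.IsStepNilpotent k) :
    g.supermanifold ⊗ g.supermanifold ⟶ g.supermanifold :=
  SmoothMap.mk
    (fun n z => bch (onPts (fst g.supermanifold g.supermanifold) n z)
      (onPts (snd g.supermanifold g.supermanifold) n z))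
    (fun {m n} f z => by
      have h1 : onPts (fst g.supermanifold g.supermanifold) n (Pts.map _ f z)
          = Pts.mapLie g f (onPts (fst g.supermanifold g.supermanifold) m z) :=
        SmoothMap.naturality (fst g.supermanifold g.supermanifold) f z
      have h2 : onPts (snd g.supermanifold g.supermanifold) n (Pts.map _ f z)
          = Pts.mapLie g f (onPts (snd g.supermanifold g.supermanifold) m z) :=
        SmoothMap.naturality (snd g.supermanifold g.supermanifold) f z
      rw [h1, h2]
      exact (map_bch (Pts.mapLie g f) fun d hd =>
        (h.nestedVanish m).bchTerm_eq_zero _ _ hd).symm)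
    (fun n => by
      -- The bound on the degree is independent of the point `z`, so the product is one fixed finite
      -- sum of smooth terms.
      have e : ∀ z, bch (onPts (fst g.supermanifold g.supermanifold) n z)
          (onPts (snd g.supermanifold g.supermanifold) n z)
          = ∑ d ∈ Finset.range (k + 1),
            SuperGeom.bchTerm d (onPts (fst g.supermanifold g.supermanifold) n z)
              (onPts (snd g.supermanifold g.supermanifold) n z) := fun z =>
        bch_eq_sum fun d hd => (h.nestedVanish n).bchTerm_eq_zero _ _ hd
      simp only [e]
      exact EvenSmooth.sum _ fun d _ => EvenSmooth.bchTerm d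
        (SmoothMap.smooth (fst g.supermanifold g.supermanifold) n)
        (SmoothMap.smooth (snd g.supermanifold g.supermanifold) n))

theorem onPts_bchMul {k : ℕ} (h : g.IsStepNilpotent k) (n : ℕ)
    (z : (g.supermanifold ⊗ g.supermanifold).pts n) :
    onPts (bchMul h) n z = bch (onPts (fst g.supermanifold g.supermanifold) n z)
      (onPts (snd g.supermanifold g.supermanifold) n z) := rfl

/-- The inverse `X ↦ -X`. -/
noncomputable def negHom (g : LieSuperalgebra.{u}) : g.supermanifold ⟶ g.supermanifold :=
  SmoothMap.mk (fun _ x => -x) (fun f x => (map_neg (Pts.map _ f) x).symm)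
    (fun _ => EvenSmooth.linear (-LinearMap.id))

/-- The morphism that is constantly `0`. -/
noncomputable def zeroHom (M N : LinearSupermanifold.{u}) : M ⟶ N :=
  SmoothMap.mk (fun _ _ => 0) (fun f _ => (map_zero (Pts.map _ f)).symm) (fun _ => EvenSmooth.zero)

/-- Taking the composite as an equation lets the categorical identities for whiskering, associators
and lifts be read off on points. -/
theorem onPts_fst_comp {T M N : LinearSupermanifold.{u}} (f : T ⟶ M ⊗ N) {f' : T ⟶ M}
    (h : f ≫ fst M N = f') (n : ℕ) (x : T.pts n) :
    onPts (fst M N) n (onPts f n x) = onPts f' n x := by rw [← h]; rfl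

theorem onPts_snd_comp {T M N : LinearSupermanifold.{u}} (f : T ⟶ M ⊗ N) {f' : T ⟶ N}
    (h : f ≫ snd M N = f') (n : ℕ) (x : T.pts n) :
    onPts (snd M N) n (onPts f n x) = onPts f' n x := by rw [← h]; rfl

/-- The supergroup structure given by the Baker–Campbell–Hausdorff product. -/
noncomputable abbrev bchGrpObj {k : ℕ} (h : g.IsStepNilpotent k) : GrpObj g.supermanifold where
  one := zeroHom _ _
  mul := bchMul h
  inv := negHom g
  one_mul := hom_ext fun n z => by
    rw [onPts_comp, onPts_bchMul, onPts_fst_comp _ (whiskerRight_fst _ _),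
      onPts_snd_comp _ (whiskerRight_snd _ _)]
    exact (zero_bch _).trans rfl
  mul_one := hom_ext fun n z => by
    rw [onPts_comp, onPts_bchMul, onPts_fst_comp _ (whiskerLeft_fst _ _),
      onPts_snd_comp _ (whiskerLeft_snd _ _)]
    exact (bch_zero _).trans rfl
  mul_assoc := hom_ext fun n z => by
    rw [onPts_comp, onPts_comp, onPts_comp, onPts_bchMul, onPts_bchMul,
      onPts_fst_comp _ (whiskerRight_fst _ _), onPts_snd_comp _ (whiskerRight_snd _ _),
      onPts_fst_comp _ (whiskerLeft_fst _ _), onPts_snd_comp _ (whiskerLeft_snd _ _),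
      onPts_comp, onPts_comp, onPts_bchMul, onPts_bchMul,
      onPts_fst_comp _ (associator_hom_fst _ _ _)]
    rw [onPts_comp, (h.nestedVanish n).bch_assoc]
    congr 2
    · rw [← onPts_comp, ← onPts_comp, ← onPts_comp, associator_hom_snd_fst]
    · rw [← onPts_comp, ← onPts_comp, associator_hom_snd_snd]
  left_inv := hom_ext fun n x => by
    rw [onPts_comp, onPts_bchMul, onPts_fst_comp _ (lift_fst _ _),
      onPts_snd_comp _ (lift_snd _ _), onPts_id]
    change bch (-x) x = 0
    rw [bch_of_commute (by rw [neg_lie, lie_self, neg_zero]), neg_add_cancel]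
  right_inv := hom_ext fun n x => by
    rw [onPts_comp, onPts_bchMul, onPts_fst_comp _ (lift_fst _ _),
      onPts_snd_comp _ (lift_snd _ _), onPts_id]
    change bch x (-x) = 0
    rw [bch_of_commute (by rw [lie_neg, lie_self, neg_zero]), add_neg_cancel]

end Supergroup

end SuperGeom

theorem mainTheorem5 (𝔫 : LieSuperalgebra.{u}) (h𝔫 : 𝔫.IsNilpotent) :
    (∀ n : ℕ, LieRing.IsNilpotent (𝔫.supermanifold.pts n)) ∧
    (∃ K : ℕ, ∀ (n : ℕ) (X Y : 𝔫.supermanifold.pts n) (d : ℕ), K < d → bchTerm d X Y = 0) ∧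
    ∃ N : GrpObj 𝔫.supermanifold,
      (∀ (n : ℕ) (X Y : 𝔫.supermanifold.pts n),
        onPts N.mul n (pair X Y) = bch X Y) ∧
      (∀ (n : ℕ) (X : 𝔫.supermanifold.pts n), onPts N.inv n X = -X) ∧
      (∀ (n : ℕ) (t : (𝟙_ LinearSupermanifold.{u}).pts n), onPts N.one n t = 0) := by
  obtain ⟨k, hk⟩ := h𝔫
  refine ⟨fun n => (hk.nestedVanish n).isNilpotent,
    ⟨k, fun n X Y d hd => (hk.nestedVanish n).bchTerm_eq_zero X Y hd⟩,
    bchGrpObj hk, fun n X Y => ?_, fun n X => rfl, fun n t => rfl⟩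
  change onPts (bchMul hk) n (pair X Y) = _
  rw [onPts_bchMul, fst_pair, snd_pair]
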